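/- Let $m\ge 1$, $n_Q\ge 0$ be integers and $n=m\,n_Q$; divide $n$ qubits into $n_Q$ consecutive blocks of $m$ qubits. Let $X$ be a set of inputs, and for $x\in X$ let $U_{\rm enc}(x)$ be a unitary on $n$ qubits and $|\psi(x)\rangle=U_{\rm enc}(x)|0\rangle^{\otimes n}$. Let $\mathcal O$ be a traceless Hermitian $2^m\times 2^m$ matrix, and let $O=\sum_{k=1}^{n_Q} I\otimes\mathcal O\otimes I$ with $\mathcal O$ acting on the $k$-th block. For $i=1,2,\dots$ and $k=1,\dots,n_Q$ let $U_i^k$ be independent random unitaries on $m$ qubits, each distributed according to a unitary 2-design (its degree-$(2,2)$ moments, i.e. the expectations of products of two entries and two conjugated entries, are those of Haar measure); put $U_i=U_i^1\otimes\cdots\otimes U_i^{n_Q}$ and $f^Q(x)_i=\langle\psi(x)|U_i^\dagger O U_i|\psi(x)\rangle$. Let $W_1,W_2,\dots$ and $b$ be standard normal variables, all independent of each other and of the unitaries. For $\xi\in\mathbb R$ consider the output at initialization of the hybrid network with $L=1$ classical layer and width $n_0$, $$f_{n_0}(x)=\frac1{\sqrt{n_0}}\sum_{i=1}^{n_0}W_i\,f^Q(x)_i+\xi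 b .$$ Let $\rho_x^k$ be the reduced density matrix of $|\psi(x)\rangle\langle\psi(x)|$ on the $k$-th block. Suppose $$\xi=\sqrt{\frac{n_Q\,{\rm Tr}(\mathcal O^2)}{(2^{2m}-1)\,2^m}} .$$ Then, as $n_0\to\infty$, the output function $f_{n_0}$ converges, in the sense of finite-dimensional distributions, to a centered Gaussian process on $X$ (every process that is such a limit is centered Gaussian) with covariance $$\Sigma(x,x')=\frac{{\rm Tr}(\mathcal O^2)}{2^{2m}-1}\sum_{k=1}^{n_Q}{\rm Tr}(\rho_x^k\rho_{x'}^k),$$ that is, a constant multiple of the projected quantum kernel $\sum_k{\rm Tr}(\rho_x^k\rho_{x'}^k)$; moreover ${\rm Cov}(f_{n_0}(x),f_{n_0}(x'))\to\Sigma(x,x')$ for all $x,x'\in X$. -/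

import Mathlib

open MeasureTheory ProbabilityTheory Filter Topology

namespace QCNN

/-! ### The compact group of unitary matrices -/

instance instCompactSpaceUnitary {d : Type*} [Fintype d] [DecidableEq d] :
    CompactSpace (Matrix.unitaryGroup d ℂ) := by
  refine isCompact_iff_compactSpace.mp ?_
  have hK : IsCompact (Set.pi Set.univ fun _ : d => Set.pi Set.univ fun _ : d =>
      Metric.closedBall (0 : ℂ) 1) :=
    isCompact_univ_pi fun _ => isCompact_univ_pi fun _ => isCompact_closedBall _ _
  have hcl : IsClosed (Matrix.unitaryGroup d ℂ : Set (Matrix d d ℂ)) := by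
    have : (Matrix.unitaryGroup d ℂ : Set (Matrix d d ℂ)) =
        {A | star A * A = 1} ∩ {A | A * star A = 1} := by
      ext A
      exact Unitary.mem_iff
    rw [this]
    exact (isClosed_eq (by fun_prop) continuous_const).inter
      (isClosed_eq (by fun_prop) continuous_const)
  refine IsCompact.of_isClosed_subset hK hcl ?_
  intro A hA i _ j _
  simpa using entry_norm_bound_of_unitary hA i j

noncomputable instance instMeasurableSpaceUnitary {d : Type*} [Fintype d] [DecidableEq d] :
    MeasurableSpace (Matrix.unitaryGroup d ℂ) := borel _

instance instBorelSpaceUnitary {d : Type*} [Fintype d] [DecidableEq d] :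
    BorelSpace (Matrix.unitaryGroup d ℂ) := ⟨rfl⟩

/-- The Haar probability measure on the unitary group. -/
noncomputable def haarUnitary (d : Type*) [Fintype d] [DecidableEq d] :
    Measure (Matrix.unitaryGroup d ℂ) :=
  Measure.haarMeasure ⊤

/-- A unitary 2-design: a probability distribution on the unitary group under which every monomial
of degree two in the entries of `U` and degree two in their complex conjugates has the same
expectation as under the Haar measure. -/
def IsUnitaryTwoDesign {d : Type*} [Fintype d] [DecidableEq d]
    (ν : ProbabilityMeasure (Matrix.unitaryGroup d ℂ)) : Prop :=
  ∀ a b c e a' b' c' e' : d,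
    ∫ U, U.1 a b * U.1 c e * star (U.1 a' b') * star (U.1 c' e')
        ∂(ν : Measure (Matrix.unitaryGroup d ℂ)) =
      ∫ U, U.1 a b * U.1 c e * star (U.1 a' b') * star (U.1 c' e') ∂(haarUnitary d)

/-! ### Qubit registers -/

/-- Computational basis labels (bit strings) of a block of `m` qubits. -/
abbrev Block (m : ℕ) : Type := Fin m → Fin 2

/-- Computational basis labels of a register of `n = nQ * m` qubits, arranged in `nQ` consecutive
blocks of `m` qubits. -/
abbrev Register (m nQ : ℕ) : Type := Fin nQ → Block m

/-- The tensor product `A 0 ⊗ A 1 ⊗ ⋯ ⊗ A (nQ - 1)` of matrices acting on the blocks. -/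
def tensor {m nQ : ℕ} (A : Fin nQ → Matrix (Block m) (Block m) ℂ) :
    Matrix (Register m nQ) (Register m nQ) ℂ :=
  fun s t => ∏ k, A k (s k) (t k)

/-- The observable `∑ k, I ⊗ 𝒪 ⊗ I`, with `𝒪` acting on the `k`-th block. -/
def observable {m : ℕ} (nQ : ℕ) (𝒪 : Matrix (Block m) (Block m) ℂ) :
    Matrix (Register m nQ) (Register m nQ) ℂ :=
  ∑ k : Fin nQ, tensor (Function.update (fun _ => 1) k 𝒪)

/-- The encoded state `|ψ⟩ = V |0⟩^{⊗ n}`. -/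
def encodedState {m nQ : ℕ} (V : Matrix.unitaryGroup (Register m nQ) ℂ) : Register m nQ → ℂ :=
  V.1.mulVec (Pi.single (fun _ _ => 0) 1)

/-- Partial trace over all blocks except the `k`-th one. -/
def reduceToBlock {m nQ : ℕ} (k : Fin nQ) (M : Matrix (Register m nQ) (Register m nQ) ℂ) :
    Matrix (Block m) (Block m) ℂ :=
  fun a b => ∑ r : {j : Fin nQ // j ≠ k} → Block m,
    M ((Equiv.funSplitAt k (Block m)).symm (a, r)) ((Equiv.funSplitAt k (Block m)).symm (b, r))

/-- The reduced density matrix of `V |0⟩⟨0| V†` on the `k`-th block. -/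
def reducedDensity {m nQ : ℕ} (V : Matrix.unitaryGroup (Register m nQ) ℂ) (k : Fin nQ) :
    Matrix (Block m) (Block m) ℂ :=
  reduceToBlock k (Matrix.vecMulVec (encodedState V) (star (encodedState V)))

/-- The projected quantum kernel `∑ k, Tr (ρ_x^k ρ_{x'}^k)`. Each trace is a real number, the
factors being Hermitian. -/
def projectedQuantumKernel {X : Type*} {m nQ : ℕ}
    (Uenc : X → Matrix.unitaryGroup (Register m nQ) ℂ) (x x' : X) : ℝ :=
  ∑ k : Fin nQ, (reducedDensity (Uenc x) k * reducedDensity (Uenc x') k).trace.re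

/-! ### The hybrid network with one classical layer -/

/-- The quantum feature `⟨ψ| U† O U |ψ⟩` for `U = U 0 ⊗ ⋯ ⊗ U (nQ - 1)`; it is a real number when
`𝒪` is Hermitian. -/
def quantumFeature {m nQ : ℕ} (𝒪 : Matrix (Block m) (Block m) ℂ)
    (V : Matrix.unitaryGroup (Register m nQ) ℂ)
    (U : Fin nQ → Matrix.unitaryGroup (Block m) ℂ) : ℝ :=
  (star (encodedState V) ⬝ᵥ
    ((tensor fun k => (U k).1).conjTranspose * observable nQ 𝒪 * tensor fun k => (U k).1).mulVec
      (encodedState V)).re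

/-- All random parameters of the network of width `n₀` at initialization: the local random
unitaries `U_i^k`, the weights `W_i` (one output node), and the bias `b`. -/
abbrev Params (m nQ n₀ : ℕ) : Type :=
  (Fin n₀ → Fin nQ → Matrix.unitaryGroup (Block m) ℂ) × (Fin n₀ → ℝ) × ℝ

/-- The law of the parameters at initialization: all of them are independent, `U_i^k` has law
`ν i k`, and the weights and the bias are standard normal. -/
noncomputable abbrev initLaw {m nQ : ℕ}
    (ν : ℕ → Fin nQ → ProbabilityMeasure (Matrix.unitaryGroup (Block m) ℂ)) (n₀ : ℕ) :
    Measure (Params m nQ n₀) :=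
  (Measure.pi fun i : Fin n₀ => Measure.pi fun k =>
      (ν i k : Measure (Matrix.unitaryGroup (Block m) ℂ))).prod
    ((Measure.pi fun _ : Fin n₀ => gaussianReal 0 1).prod (gaussianReal 0 1))

/-- The output at initialization `f(x) = n₀^{-1/2} ∑ i, W_i f^Q(x)_i + ξ b` of the network with one
classical layer. -/
noncomputable def output {X : Type*} {m nQ : ℕ}
    (Uenc : X → Matrix.unitaryGroup (Register m nQ) ℂ) (𝒪 : Matrix (Block m) (Block m) ℂ)
    (ξ : ℝ) (n₀ : ℕ) (θ : Params m nQ n₀) (x : X) : ℝ :=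
  (1 / √(n₀ : ℝ)) * (∑ i : Fin n₀, θ.2.1 i * quantumFeature 𝒪 (Uenc x) (θ.1 i)) + ξ * θ.2.2

/-- `G`, a probability law on functions `X → ℝ`, is the limit of the output function at
initialization as the width tends to infinity: all finite-dimensional distributions converge. -/
def IsInfiniteWidthLimit {X : Type*} {m nQ : ℕ}
    (Uenc : X → Matrix.unitaryGroup (Register m nQ) ℂ) (𝒪 : Matrix (Block m) (Block m) ℂ)
    (ν : ℕ → Fin nQ → ProbabilityMeasure (Matrix.unitaryGroup (Block m) ℂ)) (ξ : ℝ)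
    (G : ProbabilityMeasure (X → ℝ)) : Prop :=
  ∀ I : Finset X,
    TendstoInDistribution (fun (n₀ : ℕ) θ (x : I) => output Uenc 𝒪 ξ n₀ θ x) atTop
      (fun (g : X → ℝ) (x : I) => g x) (initLaw ν) (G : Measure (X → ℝ))

end QCNN

open QCNN

/-! Conditionally on the unitaries, the outputs at finitely many inputs are jointly Gaussian, with
random covariance `1/n₀ ∑ i, f^Q(x)_i f^Q(x')_i + ξ²`. The features are bounded and independent in
`i`, and their second moments do not depend on `i`, so this covariance concentrates and the limit is
Gaussian. The unitaries need not be identically distributed, since only those moments enter. In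
terms of characteristic functions, integrating out the Gaussians leaves `∏ i, E
exp(-h(U_i)²/(2n₀))`, where `h` is a linear combination of features
(`integral_cexp_gaussian_mixture`), and this product converges by `tendsto_prod_integral_exp_neg`.

The second moments are a twirl. A 2-design has the moments of Haar measure for products of two
entries of `U† 𝒪 U`, and right invariance determines these up to one constant
(`ConjInvariant.eq_of_trace_eq_zero`). A traceless `𝒪` sees only the traceless part of each `ρ_x^k`,
so a block contributes `κ (Tr(ρ_x^k ρ_{x'}^k) - 2^{-m})` with `κ = Tr(𝒪²)/(2^{2m}-1)`. The
prescribed bias variance `ξ² = κ nQ / 2^m` cancels exactly the constant, leaving `κ` times the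
projected kernel.

That kernel is a Gram kernel of finitely many real coordinates, so a Gaussian process with this
covariance can be written down explicitly (`limitLaw`). Any other limit has the same
finite-dimensional marginals, hence equals it (`IsInfiniteWidthLimit.unique`). -/

namespace QCNN

/-! ### Fourth-order arrays invariant under unitary conjugation. -/

section Twirl

lemma exists_perm_apply_pair {d : Type*} [DecidableEq d] {a b a' b' : d} (h : a ≠ b) (h' : a' ≠ b') :
    ∃ σ : Equiv.Perm d, σ a = a' ∧ σ b = b' := by
  refine ⟨Equiv.swap a a' * Equiv.swap b (Equiv.swap a a' b'), ?_⟩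
  have h1 : a ≠ Equiv.swap a a' b' := fun h0 => h' (by
    have := congrArg (Equiv.swap a a') h0
    simpa using this)
  simp [Equiv.swap_apply_of_ne_of_ne h h1]

variable {d : Type*} [Fintype d] [DecidableEq d]

/-- Invariance of a fourth-order array under the simultaneous conjugation `A ↦ V† A V` of both of
its index pairs. -/
def ConjInvariant (M : d → d → d → d → ℂ) : Prop :=
  ∀ V ∈ Matrix.unitaryGroup d ℂ, ∀ a b c e,
    M a b c e = ∑ p, ∑ q, ∑ r, ∑ s, star (V p a) * V q b * star (V r c) * V s e * M p q r s

lemma diagonal_mem_unitaryGroup (z : d → ℂ) (hz : ∀ i, star (z i) * z i = 1) :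
    Matrix.diagonal z ∈ Matrix.unitaryGroup d ℂ := by
  rw [Matrix.mem_unitaryGroup_iff', Matrix.star_eq_conjTranspose, Matrix.diagonal_conjTranspose,
    Matrix.diagonal_mul_diagonal, ← Matrix.diagonal_one]
  congr 1
  funext i
  exact hz i

lemma ConjInvariant.phase {M : d → d → d → d → ℂ} (hM : ConjInvariant M) (z : d → ℂ)
    (hz : ∀ i, star (z i) * z i = 1) (a b c e : d) :
    M a b c e = star (z a) * z b * star (z c) * z e * M a b c e := by
  conv_lhs => rw [hM _ (diagonal_mem_unitaryGroup z hz)]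
  have h (x y : d) : Matrix.diagonal z x y = if x = y then z y else 0 := by
    rw [Matrix.diagonal_apply]; split_ifs with h <;> simp [h]
  simp only [h, apply_ite star, star_zero, ite_mul, zero_mul, mul_ite, mul_zero,
    Finset.sum_ite_eq', Finset.mem_univ, if_true]

lemma ConjInvariant.perm {M : d → d → d → d → ℂ} (hM : ConjInvariant M) (σ : Equiv.Perm d)
    (a b c e : d) : M a b c e = M (σ a) (σ b) (σ c) (σ e) := by
  have hV : (Matrix.of fun p q => if σ q = p then 1 else 0 : Matrix d d ℂ) ∈ Matrix.unitaryGroup d ℂ := by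
    rw [Matrix.mem_unitaryGroup_iff', Matrix.star_eq_conjTranspose]
    ext p q
    simp [Matrix.mul_apply, Matrix.conjTranspose_apply, Matrix.one_apply, eq_comm]
  conv_lhs => rw [hM _ hV]
  simp

/-- The phase at site `j` multiplies the entry by a power of `I` whose exponent is the net charge in
`h`. That charge lies between `-2` and `2`, and `I` has order four, so a nonzero charge forces the
entry to vanish; the phase `-1` would miss charge `±2`. -/
lemma ConjInvariant.eq_zero_of_phase {M : d → d → d → d → ℂ} (hM : ConjInvariant M) (j : d)
    {a b c e : d}
    (h : ((if a = j then -1 else 0) + (if b = j then 1 else 0) + (if c = j then -1 else 0) +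
      (if e = j then 1 else 0) : ℤ) ≠ 0) : M a b c e = 0 := by
  have key := hM.phase (fun i => if i = j then Complex.I else 1)
    (fun i => by by_cases hi : i = j <;> simp [hi]) a b c e
  have aux (w : ℂ) (hw : w ≠ 1) (x : ℂ) (hx : x = w * x) : x = 0 := by
    have : (1 - w) * x = 0 := by linear_combination hx
    rcases mul_eq_zero.1 this with h | h
    · exact absurd (by linear_combination -h) hw
    · exact h
  refine aux _ ?_ _ key
  by_cases ha : a = j <;> by_cases hb : b = j <;> by_cases hc : c = j <;> by_cases he : e = j <;>
    simp only [ha, hb, hc, he, if_true, if_false] at h ⊢ <;>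
    first
      | (norm_num [Complex.ext_iff]; done)
      | norm_num at h

/-- The reflection `1 - 2 v vᵀ / |v|²` with `v = (3, 4)` in the `a`, `c` plane; the 3-4-5 triple
keeps all entries rational. -/
lemma householder_mem_unitaryGroup {a c : d} (hac : a ≠ c) :
    (1 - (2 / 25 : ℂ) • Matrix.vecMulVec (Pi.single a 3 + Pi.single c 4 : d → ℂ)
      (Pi.single a 3 + Pi.single c 4)) ∈ Matrix.unitaryGroup d ℂ := by
  set v : d → ℂ := Pi.single a 3 + Pi.single c 4 with hv
  have hstar : star v = v := by
    funext i
    simp only [hv, Pi.star_apply, Pi.add_apply, Pi.single_apply]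
    split_ifs <;> simp
  have hsq : v ⬝ᵥ v = 25 := by
    simp [hv, hac, hac.symm, dotProduct_add]
    norm_num
  have hH : star (1 - (2 / 25 : ℂ) • Matrix.vecMulVec v v) =
      1 - (2 / 25 : ℂ) • Matrix.vecMulVec v v := by
    rw [Matrix.star_eq_conjTranspose, Matrix.conjTranspose_sub, Matrix.conjTranspose_smul,
      Matrix.conjTranspose_vecMulVec, hstar]
    simp
  rw [Matrix.mem_unitaryGroup_iff', hH]
  have h2 : Matrix.vecMulVec v v * Matrix.vecMulVec v v = (25 : ℂ) • Matrix.vecMulVec v v := by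
    rw [Matrix.vecMulVec_mul_vecMulVec, hsq]
    ext i j
    simp only [Matrix.vecMulVec_apply, Matrix.smul_apply, Pi.smul_apply, smul_eq_mul]
    ring
  rw [sub_mul, one_mul, mul_sub, mul_one, smul_mul_smul_comm, h2, smul_smul]
  module

/-- Diagonal phases and permutations do not relate the three surviving types of entries; a genuine
mixing of two basis vectors does. With `x = 7/25` and `y = -24/25`, expanding `M a a a a` and
dropping charged entries gives `q = (x⁴ + y⁴) q + 2x²y² (p + r)`, and `1 - x⁴ - y⁴ = 2x²y²` because
`x² + y² = 1`. -/
lemma ConjInvariant.diag_eq_add {M : d → d → d → d → ℂ} (hM : ConjInvariant M) {a c : d}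
    (hac : a ≠ c) : M a a a a = M a a c c + M a c c a := by
  have hV := householder_mem_unitaryGroup hac
  set V := (1 - (2 / 25 : ℂ) • Matrix.vecMulVec (Pi.single a 3 + Pi.single c 4 : d → ℂ)
      (Pi.single a 3 + Pi.single c 4)) with hVdef
  have hcol (p : d) : V p a = (if p = a then 7 / 25 else 0) - (if p = c then 24 / 25 else 0) := by
    simp only [hVdef, Matrix.sub_apply, Matrix.one_apply, Matrix.smul_apply,
      Matrix.vecMulVec_apply, Pi.add_apply, Pi.single_apply, smul_eq_mul]
    by_cases h1 : p = a
    · subst h1; simp [hac]; norm_num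
    · by_cases h2 : p = c
      · subst h2; simp [h1, hac]; norm_num
      · simp [h1, h2]
  have hcol' (p : d) : star (V p a) = V p a := by
    rw [hcol]; split_ifs <;> simp
  have hsum (f : d → ℂ) : ∑ p, V p a * f p = 7 / 25 * f a - 24 / 25 * f c := by
    simp [hcol, sub_mul, Finset.sum_sub_distrib]
  have key := hM V hV a a a a
  simp only [hcol', mul_assoc, ← Finset.mul_sum, hsum] at key
  have z1 : M a a a c = 0 := hM.eq_zero_of_phase c (by simp [hac])
  have z2 : M a a c a = 0 := hM.eq_zero_of_phase c (by simp [hac])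
  have z3 : M a c a a = 0 := hM.eq_zero_of_phase c (by simp [hac])
  have z4 : M c a a a = 0 := hM.eq_zero_of_phase c (by simp [hac])
  have z5 : M c c c a = 0 := hM.eq_zero_of_phase a (by simp [hac.symm])
  have z6 : M c c a c = 0 := hM.eq_zero_of_phase a (by simp [hac.symm])
  have z7 : M c a c c = 0 := hM.eq_zero_of_phase a (by simp [hac.symm])
  have z8 : M a c c c = 0 := hM.eq_zero_of_phase a (by simp [hac.symm])
  have z9 : M a c a c = 0 := hM.eq_zero_of_phase a (by simp [hac.symm])
  have z10 : M c a c a = 0 := hM.eq_zero_of_phase a (by simp [hac.symm])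
  have e1 : M c c c c = M a a a a := by
    simpa using hM.perm (Equiv.swap a c) c c c c
  have e2 : M c c a a = M a a c c := by
    simpa using hM.perm (Equiv.swap a c) c c a a
  have e3 : M c a a c = M a c c a := by
    simpa using hM.perm (Equiv.swap a c) c a a c
  rw [z1, z2, z3, z4, z5, z6, z7, z8, z9, z10, e1, e2, e3] at key
  -- The coefficient is `1 / (2x²y²) = 25⁴ / (2 · 168²)`.
  linear_combination (390625 / 56448 : ℂ) * key

/-- A conjugation invariant fourth-order array whose first pair has zero trace is determined by one
contraction. -/
lemma ConjInvariant.eq_of_trace_eq_zero {M : d → d → d → d → ℂ} (hM : ConjInvariant M)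
    (hd : 2 ≤ Fintype.card d) (htr : ∀ c, ∑ a, M a a c c = 0) {T : ℂ}
    (hT : ∑ a, ∑ b, M a b b a = T) (a b c e : d) :
    M a b c e = T / ((Fintype.card d : ℂ) ^ 2 - 1) *
      ((if a = e then 1 else 0) * (if b = c then 1 else 0) -
        (if a = b then 1 else 0) * (if c = e then 1 else 0) / Fintype.card d) := by
  obtain ⟨i, j, hij⟩ := Fintype.exists_pair_of_one_lt_card (show 1 < Fintype.card d by omega)
  set n := (Fintype.card d : ℂ) with hn
  have hqp : ∀ k, M k k k k = M i i i i := fun k => by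
    simpa using hM.perm (Equiv.swap k i) k k k k
  have hp : ∀ k l, k ≠ l → M k k l l = M i i j j := fun k l h => by
    obtain ⟨σ, h1, h2⟩ := exists_perm_apply_pair h hij
    simpa [h1, h2] using hM.perm σ k k l l
  have hr : ∀ k l, k ≠ l → M k l l k = M i j j i := fun k l h => by
    obtain ⟨σ, h1, h2⟩ := exists_perm_apply_pair h hij
    simpa [h1, h2] using hM.perm σ k l l k
  -- By permutation invariance three unknowns remain. They solve `q = p + r`, the trace condition `q
  -- + (n-1) p = 0` and the contraction `n (q + (n-1) r) = T`, whence `T = (n² - 1) r` and `p = -r /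
  -- n`.
  set q := M i i i i
  set p := M i i j j
  set r := M i j j i
  have hq : q = p + r := hM.diag_eq_add hij
  have hsum (x y : ℂ) (k : d) : ∑ l, (if l = k then x else y) = x + (n - 1) * y := by
    have : ∀ l, (if l = k then x else y) = (if l = k then x - y else 0) + y := fun l => by
      split_ifs <;> ring
    simp only [this, Finset.sum_add_distrib, Finset.sum_ite_eq', Finset.mem_univ, if_true,
      Finset.sum_const, Finset.card_univ, nsmul_eq_mul, ← hn]
    ring
  have h1 : q + (n - 1) * p = 0 := by
    rw [← hsum q p i, ← htr i]
    refine Finset.sum_congr rfl fun l _ => ?_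
    split_ifs with h
    · rw [h]
    · rw [hp l i h]
  have h2 : n * (q + (n - 1) * r) = T := by
    rw [← hT]
    have : ∀ k, ∑ l, M k l l k = q + (n - 1) * r := fun k => by
      rw [← hsum q r k]
      refine Finset.sum_congr rfl fun l _ => ?_
      split_ifs with h
      · rw [h, hqp]
      · rw [hr k l (Ne.symm h)]
    simp only [this, Finset.sum_const, Finset.card_univ, nsmul_eq_mul, ← hn]
  have hn0 : n ≠ 0 := by rw [hn]; exact_mod_cast (by omega)
  have hn1 : n ^ 2 - 1 ≠ 0 := by
    have : ((Fintype.card d : ℕ) : ℝ) ^ 2 - 1 ≠ 0 := by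
      have : (2 : ℝ) ≤ Fintype.card d := by exact_mod_cast hd
      nlinarith
    rw [hn]; exact_mod_cast this
  have hrT : r = T / (n ^ 2 - 1) := by
    rw [eq_div_iff hn1]
    linear_combination h2 - h1 - (n - 1) * hq
  have hpT : p = T / (n ^ 2 - 1) * (-(1 / n)) := by
    rw [← hrT]
    field_simp
    linear_combination h1 - hq
  -- Index patterns other than `aaaa`, `aacc` and `abba` carry a nonzero charge at some site and
  -- vanish.
  by_cases hab : a = b
  · subst hab
    by_cases hce : c = e
    · subst hce
      by_cases hac : a = c
      · subst hac
        rw [hqp, hq, hrT, hpT]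
        simp
        ring
      · rw [hp a c hac, hpT]
        simp [hac]
    · have hz : M a a c e = 0 := hM.eq_zero_of_phase c (by
        by_cases hac : a = c <;> simp [hac, Ne.symm hce])
      rw [hz]
      by_cases hac : a = c
      · subst hac; simp [hce]
      · simp [hac, hce]
  · by_cases hae : a = e
    · subst hae
      by_cases hbc : b = c
      · subst hbc
        rw [hr a b hab, hrT]
        simp [hab]
      · have hz : M a b c a = 0 := hM.eq_zero_of_phase b (by
          simp [hab, Ne.symm hbc])
        rw [hz]
        simp [hbc, hab]
    · have hz : M a b c e = 0 := hM.eq_zero_of_phase a (by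
        by_cases hac : c = a <;> simp [hac, Ne.symm hab, Ne.symm hae])
      rw [hz]
      simp [hab, hae]

end Twirl

/-! ### Haar measure and second moments of `U† B U` under a 2-design. -/

section Moments

variable {d : Type*} [Fintype d] [DecidableEq d]

instance instIsHaarMeasureHaarUnitary : (haarUnitary d).IsHaarMeasure := by
  unfold haarUnitary; infer_instance

instance instIsProbabilityMeasureHaarUnitary : IsProbabilityMeasure (haarUnitary d) :=
  ⟨by simpa [haarUnitary] using
    Measure.haarMeasure_self (K₀ := (⊤ : TopologicalSpace.PositiveCompacts
      (Matrix.unitaryGroup d ℂ)))⟩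

/-- Unimodularity of a compact group: a right translate of Haar measure is again a left-invariant
probability measure, so uniqueness applies. -/
lemma map_mul_right_haarUnitary (V : Matrix.unitaryGroup d ℂ) :
    (haarUnitary d).map (· * V) = haarUnitary d := by
  have : IsProbabilityMeasure ((haarUnitary d).map (· * V)) :=
    Measure.isProbabilityMeasure_map (measurable_mul_const V).aemeasurable
  have : ((haarUnitary d).map (· * V)).IsHaarMeasure :=
    Measure.isHaarMeasure_of_isCompact_nonempty_interior _ Set.univ isCompact_univ (by simp)
      (by simp) (by simp)
  exact Measure.isHaarMeasure_eq_of_isProbabilityMeasure _ _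

lemma integral_mul_right_haarUnitary (f : Matrix.unitaryGroup d ℂ → ℂ)
    (V : Matrix.unitaryGroup d ℂ) :
    ∫ U, f (U * V) ∂(haarUnitary d) = ∫ U, f U ∂(haarUnitary d) := by
  have : (haarUnitary d).IsMulRightInvariant := ⟨map_mul_right_haarUnitary⟩
  exact integral_mul_right_eq_self f V

/-- The Heisenberg evolution `U† B U`. -/
def conjBy (B : Matrix d d ℂ) (U : Matrix.unitaryGroup d ℂ) : Matrix d d ℂ :=
  U.1.conjTranspose * B * U.1

lemma continuous_conjBy (B : Matrix d d ℂ) : Continuous (conjBy B) := by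
  unfold conjBy; fun_prop

@[fun_prop]
lemma continuous_conjBy_apply (B : Matrix d d ℂ) (a b : d) :
    Continuous fun U => conjBy B U a b :=
  (continuous_conjBy B).matrix_elem a b

@[fun_prop]
lemma continuous_unitary_entry (a b : d) :
    Continuous fun U : Matrix.unitaryGroup d ℂ => U.1 a b :=
  continuous_subtype_val.matrix_elem a b

lemma integrable_of_continuous_unitary {E : Type*} [NormedAddCommGroup E]
    {f : Matrix.unitaryGroup d ℂ → E} (hf : Continuous f)
    (μ : Measure (Matrix.unitaryGroup d ℂ)) [IsFiniteMeasure μ] : Integrable f μ :=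
  hf.integrable_of_hasCompactSupport (HasCompactSupport.of_compactSpace f)

lemma conjBy_mul (B : Matrix d d ℂ) (U V : Matrix.unitaryGroup d ℂ) (a b : d) :
    conjBy B (U * V) a b = ∑ p, ∑ q, star (V.1 p a) * V.1 q b * conjBy B U p q := by
  have : conjBy B (U * V) = V.1.conjTranspose * conjBy B U * V.1 := by
    simp [conjBy, Matrix.conjTranspose_mul, Matrix.mul_assoc]
  rw [this, Matrix.mul_apply, Finset.sum_comm]
  refine Finset.sum_congr rfl fun q _ => ?_
  rw [Matrix.mul_apply, Finset.sum_mul]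
  refine Finset.sum_congr rfl fun p _ => ?_
  rw [Matrix.conjTranspose_apply]
  ring

lemma conjBy_one (U : Matrix.unitaryGroup d ℂ) : conjBy 1 U = 1 := by
  have := Matrix.mem_unitaryGroup_iff'.1 U.2
  simpa [conjBy, Matrix.star_eq_conjTranspose] using this

lemma conjBy_mul_conjBy (B B' : Matrix d d ℂ) (U : Matrix.unitaryGroup d ℂ) :
    conjBy B U * conjBy B' U = conjBy (B * B') U := by
  have h := Matrix.mem_unitaryGroup_iff.1 U.2
  rw [Matrix.star_eq_conjTranspose] at h
  calc conjBy B U * conjBy B' U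
      = U.1.conjTranspose * B * (U.1 * U.1.conjTranspose) * B' * U.1 := by
        simp only [conjBy, Matrix.mul_assoc]
    _ = conjBy (B * B') U := by rw [h, Matrix.mul_one]; simp only [conjBy, Matrix.mul_assoc]

lemma trace_conjBy (B : Matrix d d ℂ) (U : Matrix.unitaryGroup d ℂ) :
    (conjBy B U).trace = B.trace := by
  have h := Matrix.mem_unitaryGroup_iff.1 U.2
  rw [Matrix.star_eq_conjTranspose] at h
  rw [conjBy, Matrix.trace_mul_comm, ← Matrix.mul_assoc, h, Matrix.one_mul]

lemma isHermitian_conjBy {B : Matrix d d ℂ} (hB : B.IsHermitian) (U : Matrix.unitaryGroup d ℂ) :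
    (conjBy B U).IsHermitian :=
  Matrix.isHermitian_conjTranspose_mul_mul _ hB

lemma conjBy_apply_mul_conjBy_apply (B B' : Matrix d d ℂ) (U : Matrix.unitaryGroup d ℂ)
    (a b c e : d) :
    conjBy B U a b * conjBy B' U c e = ∑ q, ∑ p, ∑ s, ∑ r, B p q * B' r s *
      (U.1 q b * U.1 s e * star (U.1 p a) * star (U.1 r c)) := by
  simp only [conjBy, Matrix.mul_apply, Matrix.conjTranspose_apply]
  rw [Finset.sum_mul]
  refine Finset.sum_congr rfl fun q _ => ?_
  rw [Finset.sum_mul, Finset.sum_mul]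
  refine Finset.sum_congr rfl fun p _ => ?_
  rw [Finset.mul_sum]
  refine Finset.sum_congr rfl fun s _ => ?_
  rw [Finset.sum_mul, Finset.mul_sum]
  refine Finset.sum_congr rfl fun r _ => ?_
  ring

/-- A product of two entries of Heisenberg-evolved matrices is a polynomial of degree (2,2) in the
entries of `U` and their conjugates, which is what the design property controls. -/
lemma IsUnitaryTwoDesign.integral_conjBy_mul_conjBy
    {ν : ProbabilityMeasure (Matrix.unitaryGroup d ℂ)} (hν : IsUnitaryTwoDesign ν)
    (B B' : Matrix d d ℂ) (a b c e : d) :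
    ∫ U, conjBy B U a b * conjBy B' U c e ∂(ν : Measure (Matrix.unitaryGroup d ℂ)) =
      ∫ U, conjBy B U a b * conjBy B' U c e ∂(haarUnitary d) := by
  have expand (μ : Measure (Matrix.unitaryGroup d ℂ)) [IsProbabilityMeasure μ] :
      ∫ U, conjBy B U a b * conjBy B' U c e ∂μ = ∑ q, ∑ p, ∑ s, ∑ r, B p q * B' r s *
        ∫ U, U.1 q b * U.1 s e * star (U.1 p a) * star (U.1 r c) ∂μ := by
    simp only [conjBy_apply_mul_conjBy_apply]
    have hI {f : Matrix.unitaryGroup d ℂ → ℂ} (hf : Continuous f) : Integrable f μ :=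
      integrable_of_continuous_unitary hf μ
    rw [integral_finsetSum _ fun _ _ => hI (by fun_prop)]
    refine Finset.sum_congr rfl fun q _ => ?_
    rw [integral_finsetSum _ fun _ _ => hI (by fun_prop)]
    refine Finset.sum_congr rfl fun p _ => ?_
    rw [integral_finsetSum _ fun _ _ => hI (by fun_prop)]
    refine Finset.sum_congr rfl fun s _ => ?_
    rw [integral_finsetSum _ fun _ _ => hI (by fun_prop)]
    refine Finset.sum_congr rfl fun r _ => ?_
    rw [integral_const_mul]
  rw [expand, expand]
  simp only [hν _ _ _ _ _ _ _ _]

/-- Replacing `U` by `U * V` preserves Haar measure and conjugates both evolved matrices by `V`. -/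
lemma conjInvariant_haar (B B' : Matrix d d ℂ) :
    ConjInvariant fun a b c e => ∫ U, conjBy B U a b * conjBy B' U c e ∂(haarUnitary d) := by
  intro V hV a b c e
  have hI {f : Matrix.unitaryGroup d ℂ → ℂ} (hf : Continuous f) : Integrable f (haarUnitary d) :=
    integrable_of_continuous_unitary hf _
  beta_reduce
  rw [← integral_mul_right_haarUnitary _ ⟨V, hV⟩]
  have (U : Matrix.unitaryGroup d ℂ) : conjBy B (U * ⟨V, hV⟩) a b * conjBy B' (U * ⟨V, hV⟩) c e =
      ∑ p, ∑ q, ∑ r, ∑ s, star (V p a) * V q b * star (V r c) * V s e *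
        (conjBy B U p q * conjBy B' U r s) := by
    rw [conjBy_mul, conjBy_mul, Finset.sum_mul]
    refine Finset.sum_congr rfl fun p _ => ?_
    rw [Finset.sum_mul]
    refine Finset.sum_congr rfl fun q _ => ?_
    rw [Finset.mul_sum]
    refine Finset.sum_congr rfl fun r _ => ?_
    rw [Finset.mul_sum]
    refine Finset.sum_congr rfl fun s _ => ?_
    ring
  simp only [this]
  rw [integral_finsetSum _ fun _ _ => hI (by fun_prop)]
  refine Finset.sum_congr rfl fun q _ => ?_
  rw [integral_finsetSum _ fun _ _ => hI (by fun_prop)]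
  refine Finset.sum_congr rfl fun p _ => ?_
  rw [integral_finsetSum _ fun _ _ => hI (by fun_prop)]
  refine Finset.sum_congr rfl fun s _ => ?_
  rw [integral_finsetSum _ fun _ _ => hI (by fun_prop)]
  refine Finset.sum_congr rfl fun r _ => ?_
  rw [integral_const_mul]

/-- Second moments of the Heisenberg evolution of a traceless matrix and an arbitrary one under a
unitary 2-design. -/
lemma IsUnitaryTwoDesign.integral_conjBy_mul_conjBy_eq
    {ν : ProbabilityMeasure (Matrix.unitaryGroup d ℂ)} (hν : IsUnitaryTwoDesign ν)
    (hd : 2 ≤ Fintype.card d) {B : Matrix d d ℂ} (hB : B.trace = 0) (B' : Matrix d d ℂ)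
    (a b c e : d) :
    ∫ U, conjBy B U a b * conjBy B' U c e ∂(ν : Measure (Matrix.unitaryGroup d ℂ)) =
      (B * B').trace / ((Fintype.card d : ℂ) ^ 2 - 1) *
      ((if a = e then 1 else 0) * (if b = c then 1 else 0) -
        (if a = b then 1 else 0) * (if c = e then 1 else 0) / Fintype.card d) := by
  have hI {f : Matrix.unitaryGroup d ℂ → ℂ} (hf : Continuous f) : Integrable f (haarUnitary d) :=
    integrable_of_continuous_unitary hf _
  rw [hν.integral_conjBy_mul_conjBy]
  refine (conjInvariant_haar B B').eq_of_trace_eq_zero hd (fun c => ?_) ?_ a b c e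
  · rw [← integral_finsetSum _ fun _ _ => hI (by fun_prop)]
    simp only [← Finset.sum_mul]
    have (U : Matrix.unitaryGroup d ℂ) : ∑ i, conjBy B U i i = 0 := by
      rw [← hB, ← trace_conjBy B U]; rfl
    simp [this]
  -- The contraction is `Tr(U† B U U† B' U) = Tr(B B')` for every `U`, so no integral has to be
  -- computed.
  · rw [Finset.sum_congr rfl fun i _ => (integral_finsetSum Finset.univ
      (f := fun j U => conjBy B U i j * conjBy B' U j i) fun j _ => hI (by fun_prop)).symm,
      ← integral_finsetSum _ fun _ _ => hI (by fun_prop)]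
    have (U : Matrix.unitaryGroup d ℂ) :
        ∑ i, ∑ j, conjBy B U i j * conjBy B' U j i = (B * B').trace := by
      rw [← trace_conjBy _ U, ← conjBy_mul_conjBy]
      simp [Matrix.trace, Matrix.mul_apply]
    simp [this]

lemma IsUnitaryTwoDesign.integral_trace_mul_trace
    {ν : ProbabilityMeasure (Matrix.unitaryGroup d ℂ)} (hν : IsUnitaryTwoDesign ν)
    (hd : 2 ≤ Fintype.card d) {B : Matrix d d ℂ} (hB : B.trace = 0) (B' : Matrix d d ℂ)
    (ρ ρ' : Matrix d d ℂ) :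
    ∫ U, (ρ * conjBy B U).trace * (ρ' * conjBy B' U).trace
        ∂(ν : Measure (Matrix.unitaryGroup d ℂ)) =
      (B * B').trace / ((Fintype.card d : ℂ) ^ 2 - 1) *
        ((ρ * ρ').trace - ρ.trace * ρ'.trace / Fintype.card d) := by
  have hI {f : Matrix.unitaryGroup d ℂ → ℂ} (hf : Continuous f) :
      Integrable f (ν : Measure (Matrix.unitaryGroup d ℂ)) :=
    integrable_of_continuous_unitary hf _
  have expand (U : Matrix.unitaryGroup d ℂ) :
      (ρ * conjBy B U).trace * (ρ' * conjBy B' U).trace =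
        ∑ b, ∑ a, ∑ e, ∑ c, ρ b a * ρ' e c * (conjBy B U a b * conjBy B' U c e) := by
    simp only [Matrix.trace, Matrix.diag_apply, Matrix.mul_apply]
    rw [Finset.sum_mul]
    refine Finset.sum_congr rfl fun q _ => ?_
    rw [Finset.sum_mul]
    refine Finset.sum_congr rfl fun p _ => ?_
    rw [Finset.mul_sum]
    refine Finset.sum_congr rfl fun s _ => ?_
    rw [Finset.mul_sum]
    refine Finset.sum_congr rfl fun r _ => ?_
    ring
  simp only [expand]
  have : ∫ U, ∑ b, ∑ a, ∑ e, ∑ c, ρ b a * ρ' e c * (conjBy B U a b * conjBy B' U c e)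
        ∂(ν : Measure (Matrix.unitaryGroup d ℂ)) =
      ∑ b, ∑ a, ∑ e, ∑ c, ρ b a * ρ' e c * ((B * B').trace / ((Fintype.card d : ℂ) ^ 2 - 1) *
      ((if a = e then 1 else 0) * (if b = c then 1 else 0) -
        (if a = b then 1 else 0) * (if c = e then 1 else 0) / Fintype.card d)) := by
    rw [integral_finsetSum _ fun _ _ => hI (by fun_prop)]
    refine Finset.sum_congr rfl fun b _ => ?_
    rw [integral_finsetSum _ fun _ _ => hI (by fun_prop)]
    refine Finset.sum_congr rfl fun a _ => ?_
    rw [integral_finsetSum _ fun _ _ => hI (by fun_prop)]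
    refine Finset.sum_congr rfl fun e _ => ?_
    rw [integral_finsetSum _ fun _ _ => hI (by fun_prop)]
    refine Finset.sum_congr rfl fun c _ => ?_
    rw [integral_const_mul, hν.integral_conjBy_mul_conjBy_eq hd hB]
  rw [this]
  set k := (B * B').trace / ((Fintype.card d : ℂ) ^ 2 - 1)
  have h1 : ∑ b, ∑ a, ∑ e, ∑ c, ρ b a * ρ' e c *
      ((if a = e then 1 else 0) * (if b = c then 1 else 0)) = (ρ * ρ').trace := by
    simp [Matrix.trace, Matrix.mul_apply]
  have h2 : ∑ b, ∑ a, ∑ e, ∑ c, ρ b a * ρ' e c *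
      ((if a = b then 1 else 0) * (if c = e then 1 else 0)) = ρ.trace * ρ'.trace := by
    simp [Matrix.trace, Finset.sum_mul_sum]
  have h3 (b a e c : d) : ρ b a * ρ' e c * (k * ((if a = e then 1 else 0) *
      (if b = c then 1 else 0) - (if a = b then 1 else 0) * (if c = e then 1 else 0) /
        (Fintype.card d : ℂ))) =
      k * (ρ b a * ρ' e c * ((if a = e then 1 else 0) * (if b = c then 1 else 0))) -
      k / Fintype.card d *
        (ρ b a * ρ' e c * ((if a = b then 1 else 0) * (if c = e then 1 else 0))) := by
    ring
  simp only [h3, Finset.sum_sub_distrib, ← Finset.mul_sum, h1, h2]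
  ring

/-- The design property concerns degree (2,2) only; the first moment is recovered from it by taking
both `B'` and `ρ'` to be the identity, whose factor is the nonzero constant `Fintype.card d`. -/
lemma IsUnitaryTwoDesign.integral_trace_eq_zero
    {ν : ProbabilityMeasure (Matrix.unitaryGroup d ℂ)} (hν : IsUnitaryTwoDesign ν)
    (hd : 2 ≤ Fintype.card d) {B : Matrix d d ℂ} (hB : B.trace = 0) (ρ : Matrix d d ℂ) :
    ∫ U, (ρ * conjBy B U).trace ∂(ν : Measure (Matrix.unitaryGroup d ℂ)) = 0 := by
  have h := hν.integral_trace_mul_trace hd hB 1 ρ 1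
  have h0 : (Fintype.card d : ℂ) ≠ 0 := by exact_mod_cast (by omega)
  simpa [conjBy_one, integral_mul_const, hB, h0] using h

end Moments

/-! ### Reduction of quantum features to single-block traces. -/

section Features

variable {m nQ : ℕ}

lemma tensor_mul (A B : Fin nQ → Matrix (Block m) (Block m) ℂ) :
    tensor A * tensor B = tensor fun k => A k * B k := by
  ext s t
  simp only [Matrix.mul_apply, tensor]
  rw [Finset.prod_univ_sum, Fintype.piFinset_univ]
  exact Finset.sum_congr rfl fun r _ => Finset.prod_mul_distrib.symm

lemma tensor_conjTranspose (A : Fin nQ → Matrix (Block m) (Block m) ℂ) :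
    (tensor A).conjTranspose = tensor fun k => (A k).conjTranspose := by
  ext s t
  simp [tensor, Matrix.conjTranspose_apply]

lemma tensor_conj_update (𝒪 : Matrix (Block m) (Block m) ℂ)
    (U : Fin nQ → Matrix.unitaryGroup (Block m) ℂ) (k : Fin nQ) :
    (tensor fun j => (U j).1).conjTranspose * tensor (Function.update (fun _ => 1) k 𝒪) *
      tensor (fun j => (U j).1) = tensor (Function.update (fun _ => 1) k (conjBy 𝒪 (U k))) := by
  rw [tensor_conjTranspose, tensor_mul, tensor_mul]
  congr 1
  funext j
  rcases eq_or_ne j k with rfl | h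
  · simp [conjBy]
  · simpa [h, conjBy] using conjBy_one (U j)

lemma tensor_update_funSplitAt (k : Fin nQ) (A : Matrix (Block m) (Block m) ℂ) (a b : Block m)
    (r s : {j : Fin nQ // j ≠ k} → Block m) :
    tensor (Function.update (fun _ => 1) k A) ((Equiv.funSplitAt k (Block m)).symm (a, r))
      ((Equiv.funSplitAt k (Block m)).symm (b, s)) = A a b * if r = s then 1 else 0 := by
  rw [tensor, ← Finset.mul_prod_erase _ _ (Finset.mem_univ k)]
  congr 1
  · simp
  · by_cases h : r = s
    · subst h
      rw [if_pos rfl]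
      refine Finset.prod_eq_one fun j hj => ?_
      have hj' : j ≠ k := Finset.ne_of_mem_erase hj
      simp [hj']
    · rw [if_neg h]
      obtain ⟨j, hj⟩ := Function.ne_iff.1 h
      refine Finset.prod_eq_zero (i := j.1) (by simp [j.2]) ?_
      simp [j.2, hj]

/-- Each register index splits into its `k`-th block and the rest; the identity factors force the
two rests to agree, and summing over the common rest is the partial trace. -/
lemma dotProduct_tensor_update_mulVec (k : Fin nQ) (A : Matrix (Block m) (Block m) ℂ)
    (ψ : Register m nQ → ℂ) :
    star ψ ⬝ᵥ (tensor (Function.update (fun _ => 1) k A)).mulVec ψ =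
      (reduceToBlock k (Matrix.vecMulVec ψ (star ψ)) * A).trace := by
  simp only [dotProduct, Matrix.mulVec, Matrix.trace, Matrix.diag_apply, Matrix.mul_apply,
    reduceToBlock, Matrix.vecMulVec_apply]
  rw [← (Equiv.funSplitAt k (Block m)).symm.sum_comp, Fintype.sum_prod_type]
  simp only [← (Equiv.funSplitAt k (Block m)).symm.sum_comp
    (fun t => tensor (Function.update (fun _ => 1) k A) _ t * ψ t), Fintype.sum_prod_type,
    tensor_update_funSplitAt]
  simp only [mul_ite, mul_one, mul_zero, ite_mul, zero_mul, Finset.sum_ite_eq, Finset.mem_univ,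
    if_true, Finset.mul_sum, Finset.sum_mul]
  rw [Finset.sum_congr rfl fun a _ => Finset.sum_comm, Finset.sum_comm]
  refine Finset.sum_congr rfl fun a _ => Finset.sum_congr rfl fun b _ =>
    Finset.sum_congr rfl fun r _ => ?_
  simp only [Pi.star_apply]
  ring

lemma quantumFeature_eq_sum (𝒪 : Matrix (Block m) (Block m) ℂ)
    (V : Matrix.unitaryGroup (Register m nQ) ℂ)
    (U : Fin nQ → Matrix.unitaryGroup (Block m) ℂ) :
    quantumFeature 𝒪 V U = ∑ k, (reducedDensity V k * conjBy 𝒪 (U k)).trace.re := by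
  unfold quantumFeature observable
  rw [Matrix.mul_sum, Matrix.sum_mul, Matrix.sum_mulVec, dotProduct_sum, Complex.re_sum]
  refine Finset.sum_congr rfl fun k _ => ?_
  rw [tensor_conj_update, dotProduct_tensor_update_mulVec, reducedDensity]

lemma star_dotProduct_encodedState (V : Matrix.unitaryGroup (Register m nQ) ℂ) :
    star (encodedState V) ⬝ᵥ encodedState V = 1 := by
  have h := Matrix.mem_unitaryGroup_iff'.1 V.2
  rw [Matrix.star_eq_conjTranspose] at h
  rw [encodedState, Matrix.star_mulVec, Matrix.dotProduct_mulVec, Matrix.vecMul_vecMul, h]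
  simp

lemma trace_reducedDensity (V : Matrix.unitaryGroup (Register m nQ) ℂ) (k : Fin nQ) :
    (reducedDensity V k).trace = 1 := by
  have h := dotProduct_tensor_update_mulVec k (1 : Matrix (Block m) (Block m) ℂ) (encodedState V)
  have h1 : tensor (Function.update (fun _ : Fin nQ => (1 : Matrix (Block m) (Block m) ℂ)) k 1) =
      1 := by
    ext s t
    simp [tensor, Matrix.one_apply, Finset.prod_ite_zero, funext_iff]
  rw [h1, Matrix.one_mulVec, star_dotProduct_encodedState, Matrix.mul_one] at h
  exact h.symm

lemma isHermitian_reducedDensity (V : Matrix.unitaryGroup (Register m nQ) ℂ) (k : Fin nQ) :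
    (reducedDensity V k).IsHermitian := by
  ext a b
  simp [reducedDensity, reduceToBlock, Matrix.vecMulVec_apply, Matrix.conjTranspose_apply, mul_comm]

lemma trace_mul_eq_ofReal {d : Type*} [Fintype d] {A B : Matrix d d ℂ} (hA : A.IsHermitian)
    (hB : B.IsHermitian) : (A * B).trace = ((A * B).trace.re : ℂ) := by
  have : star (A * B).trace = (A * B).trace := by
    rw [← Matrix.trace_conjTranspose, Matrix.conjTranspose_mul, hA.eq, hB.eq, Matrix.trace_mul_comm]
  exact (Complex.conj_eq_iff_re.1 this).symm

/-- The trace of a product of Hermitian matrices is the sum of the products of the real parts and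
of the imaginary parts of their entries. -/
lemma trace_mul_re_eq_sum {d : Type*} [Fintype d] {A B : Matrix d d ℂ} (hB : B.IsHermitian) :
    (A * B).trace.re = ∑ a, ∑ b, ((A a b).re * (B a b).re + (A a b).im * (B a b).im) := by
  simp only [Matrix.trace, Matrix.diag_apply, Matrix.mul_apply, Complex.re_sum]
  refine Finset.sum_congr rfl fun a _ => Finset.sum_congr rfl fun b _ => ?_
  rw [← hB.apply b a]
  simp

end Features

/-! ### Second moments of the quantum features. -/

section FeatureMoments

variable {m nQ : ℕ}

/-- The expected product of the features of two inputs. -/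
noncomputable def featureKernel {X : Type*} (Uenc : X → Matrix.unitaryGroup (Register m nQ) ℂ)
    (𝒪 : Matrix (Block m) (Block m) ℂ) (x x' : X) : ℝ :=
  (𝒪 ^ 2).trace.re / ((2 : ℝ) ^ (2 * m) - 1) *
    (projectedQuantumKernel Uenc x x' - nQ / 2 ^ m)

lemma two_le_card_block (hm : 1 ≤ m) : 2 ≤ Fintype.card (Block m) := by
  have h : Fintype.card (Block m) = 2 ^ m := by simp
  rw [h]
  exact Nat.le_self_pow (by omega) 2

lemma integral_blockFeature (hm : 1 ≤ m) {𝒪 : Matrix (Block m) (Block m) ℂ}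
    (h𝒪 : 𝒪.IsHermitian) (htr : 𝒪.trace = 0)
    {ν : ProbabilityMeasure (Matrix.unitaryGroup (Block m) ℂ)} (hν : IsUnitaryTwoDesign ν)
    {ρ : Matrix (Block m) (Block m) ℂ} (hρ : ρ.IsHermitian) :
    ∫ U, (ρ * conjBy 𝒪 U).trace.re ∂(ν : Measure (Matrix.unitaryGroup (Block m) ℂ)) = 0 := by
  have hd := two_le_card_block hm
  have h := hν.integral_trace_eq_zero hd htr ρ
  rw [integral_congr_ae (Eventually.of_forall fun U =>
    trace_mul_eq_ofReal hρ (isHermitian_conjBy h𝒪 U)), integral_complex_ofReal] at h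
  exact_mod_cast h

lemma integral_blockFeature_mul (hm : 1 ≤ m) {𝒪 : Matrix (Block m) (Block m) ℂ}
    (h𝒪 : 𝒪.IsHermitian) (htr : 𝒪.trace = 0)
    {ν : ProbabilityMeasure (Matrix.unitaryGroup (Block m) ℂ)} (hν : IsUnitaryTwoDesign ν)
    {ρ ρ' : Matrix (Block m) (Block m) ℂ} (hρ : ρ.IsHermitian) (hρ' : ρ'.IsHermitian)
    (h1 : ρ.trace = 1) (h1' : ρ'.trace = 1) :
    ∫ U, (ρ * conjBy 𝒪 U).trace.re * (ρ' * conjBy 𝒪 U).trace.re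
        ∂(ν : Measure (Matrix.unitaryGroup (Block m) ℂ)) =
      (𝒪 ^ 2).trace.re / ((2 : ℝ) ^ (2 * m) - 1) * ((ρ * ρ').trace.re - 1 / 2 ^ m) := by
  have hd := two_le_card_block hm
  have h := hν.integral_trace_mul_trace hd htr 𝒪 ρ ρ'
  have e (U : Matrix.unitaryGroup (Block m) ℂ) :
      (ρ * conjBy 𝒪 U).trace * (ρ' * conjBy 𝒪 U).trace =
        (((ρ * conjBy 𝒪 U).trace.re * (ρ' * conjBy 𝒪 U).trace.re : ℝ) : ℂ) := by
    rw [Complex.ofReal_mul, ← trace_mul_eq_ofReal hρ (isHermitian_conjBy h𝒪 U),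
      ← trace_mul_eq_ofReal hρ' (isHermitian_conjBy h𝒪 U)]
  rw [integral_congr_ae (Eventually.of_forall e), integral_complex_ofReal, trace_mul_eq_ofReal hρ hρ', trace_mul_eq_ofReal h𝒪 h𝒪, h1, h1',
    ← pow_two] at h
  have hc : (Fintype.card (Block m) : ℂ) = 2 ^ m := by simp
  rw [hc, ← pow_mul, mul_comm m 2, one_mul] at h
  apply Complex.ofReal_injective
  rw [h]
  push_cast
  rfl

lemma continuous_blockFeature {d : Type*} [Fintype d] [DecidableEq d] (ρ B : Matrix d d ℂ) :
    Continuous fun U => (ρ * conjBy B U).trace.re :=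
  Complex.continuous_re.comp ((continuous_const.matrix_mul (continuous_conjBy B)).matrix_trace)

lemma measurable_quantumFeature (𝒪 : Matrix (Block m) (Block m) ℂ)
    (V : Matrix.unitaryGroup (Register m nQ) ℂ) : Measurable (quantumFeature 𝒪 V) := by
  simp only [funext fun U => quantumFeature_eq_sum 𝒪 V U]
  exact Finset.measurable_sum _ fun k _ =>
    (continuous_blockFeature _ _).measurable.comp (measurable_pi_apply k)

lemma exists_bound_quantumFeature (𝒪 : Matrix (Block m) (Block m) ℂ)
    (V : Matrix.unitaryGroup (Register m nQ) ℂ) : ∃ C, ∀ U, |quantumFeature 𝒪 V U| ≤ C := by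
  have h : Continuous (quantumFeature 𝒪 V) := by
    simp only [funext fun U => quantumFeature_eq_sum 𝒪 V U]
    exact continuous_finsetSum _ fun k _ =>
      (continuous_blockFeature _ _).comp (continuous_apply k)
  obtain ⟨C, hC⟩ := isCompact_univ.exists_bound_of_continuousOn h.continuousOn
  exact ⟨C, fun U => hC U (Set.mem_univ U)⟩

/-- The blocks are independent and their contributions centered, so cross terms vanish. The `nQ`
diagonal terms each carry `-1 / 2 ^ m`, since reduced densities have trace one. -/
lemma integral_quantumFeature_mul {X : Type*} (hm : 1 ≤ m)
    (Uenc : X → Matrix.unitaryGroup (Register m nQ) ℂ)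
    {𝒪 : Matrix (Block m) (Block m) ℂ} (h𝒪 : 𝒪.IsHermitian) (htr : 𝒪.trace = 0)
    {ν : Fin nQ → ProbabilityMeasure (Matrix.unitaryGroup (Block m) ℂ)}
    (hν : ∀ k, IsUnitaryTwoDesign (ν k)) (x x' : X) :
    ∫ U, quantumFeature 𝒪 (Uenc x) U * quantumFeature 𝒪 (Uenc x') U
        ∂(Measure.pi fun k => (ν k : Measure (Matrix.unitaryGroup (Block m) ℂ))) =
      featureKernel Uenc 𝒪 x x' := by
  set g : X → Fin nQ → Matrix.unitaryGroup (Block m) ℂ → ℝ :=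
    fun x k U => (reducedDensity (Uenc x) k * conjBy 𝒪 U).trace.re with hg
  have hgc (x k) : Continuous (g x k) := continuous_blockFeature _ _
  set P := Measure.pi fun k => (ν k : Measure (Matrix.unitaryGroup (Block m) ℂ))
  have hLp (x k) : MemLp (fun U : Fin nQ → _ => g x k (U k)) 2 P := by
    obtain ⟨C, hC⟩ := isCompact_univ.exists_bound_of_continuousOn (hgc x k).continuousOn
    exact MemLp.of_bound
      ((hgc x k).measurable.comp (measurable_pi_apply k)).aestronglyMeasurable C
      (Eventually.of_forall fun U => hC _ (Set.mem_univ _))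
  have hmean (x k) : ∫ U, g x k (U k) ∂P = 0 := by
    rw [integral_comp_eval (μ := fun k => (ν k : Measure (Matrix.unitaryGroup (Block m) ℂ)))
      (hgc x k).measurable.aestronglyMeasurable]
    exact integral_blockFeature hm h𝒪 htr (hν k) (isHermitian_reducedDensity _ _)
  have hcross (j k) (hjk : j ≠ k) : ∫ U, g x j (U j) * g x' k (U k) ∂P = 0 := by
    have hind : IndepFun (fun U : Fin nQ → _ => g x j (U j)) (fun U => g x' k (U k)) P :=
      ((iIndepFun_pi (μ := fun k => (ν k : Measure (Matrix.unitaryGroup (Block m) ℂ)))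
        (X := fun _ => id) fun _ => aemeasurable_id).indepFun hjk).comp
        (hgc x j).measurable (hgc x' k).measurable
    rw [hind.integral_fun_mul_eq_mul_integral (hLp x j).aestronglyMeasurable
      (hLp x' k).aestronglyMeasurable, hmean, zero_mul]
  have hdiag (k) : ∫ U, g x k (U k) * g x' k (U k) ∂P = (𝒪 ^ 2).trace.re /
      ((2 : ℝ) ^ (2 * m) - 1) *
      ((reducedDensity (Uenc x) k * reducedDensity (Uenc x') k).trace.re - 1 / 2 ^ m) := by
    rw [integral_comp_eval (μ := fun k => (ν k : Measure (Matrix.unitaryGroup (Block m) ℂ)))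
      (f := fun U => g x k U * g x' k U)
      ((hgc x k).mul (hgc x' k)).measurable.aestronglyMeasurable]
    exact integral_blockFeature_mul hm h𝒪 htr (hν k) (isHermitian_reducedDensity _ _)
      (isHermitian_reducedDensity _ _) (trace_reducedDensity _ _) (trace_reducedDensity _ _)
  simp only [quantumFeature_eq_sum]
  change ∫ U, (∑ j, g x j (U j)) * (∑ k, g x' k (U k)) ∂P = _
  simp only [Finset.sum_mul_sum]
  have hI (j k) : Integrable (fun U : Fin nQ → _ => g x j (U j) * g x' k (U k)) P :=
    (hLp x j).integrable_mul (hLp x' k)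
  rw [integral_finsetSum _ fun j _ => integrable_finsetSum _ fun k _ => hI j k]
  have hrow (j) : ∫ U, ∑ k, g x j (U j) * g x' k (U k) ∂P = (𝒪 ^ 2).trace.re /
      ((2 : ℝ) ^ (2 * m) - 1) *
      ((reducedDensity (Uenc x) j * reducedDensity (Uenc x') j).trace.re - 1 / 2 ^ m) := by
    rw [integral_finsetSum _ fun k _ => hI j k, Finset.sum_eq_single j
      (fun k _ hk => hcross j k hk.symm) (by simp), hdiag]
  simp only [hrow]
  rw [featureKernel, projectedQuantumKernel, ← Finset.mul_sum, Finset.sum_sub_distrib]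
  simp [div_eq_mul_inv]

end FeatureMoments

/-! ### Laplace transforms of bounded variables and Gaussian mixtures. -/

section Probability

lemma abs_exp_neg_sub_le {u : ℝ} (hu : 0 ≤ u) : |Real.exp (-u) - (1 - u)| ≤ u ^ 2 := by
  have h1 := Real.add_one_le_exp (-u)
  have h2 : Real.exp (-u) ≤ 1 / (1 + u) := by
    rw [Real.exp_neg, inv_eq_one_div]
    exact one_div_le_one_div_of_le (by linarith) (by linarith [Real.add_one_le_exp u])
  have h3 : 1 / (1 + u) ≤ 1 - u + u ^ 2 := by
    rw [div_le_iff₀ (by linarith)]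
    nlinarith [pow_nonneg hu 3]
  rw [abs_le]
  constructor <;> nlinarith

/-- Telescoping: factors are exchanged one at a time, the others being bounded by one. -/
lemma abs_prod_sub_prod_le {ι : Type*} (s : Finset ι) {a b : ι → ℝ} (ha : ∀ i, |a i| ≤ 1)
    (hb : ∀ i, |b i| ≤ 1) : |∏ i ∈ s, a i - ∏ i ∈ s, b i| ≤ ∑ i ∈ s, |a i - b i| := by
  classical
  induction s using Finset.induction_on with
  | empty => simp
  | insert i s hi ih =>
    rw [Finset.prod_insert hi, Finset.prod_insert hi, Finset.sum_insert hi]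
    have h1 : |∏ i ∈ s, b i| ≤ 1 := by
      rw [Finset.abs_prod]
      exact Finset.prod_le_one (fun _ _ => abs_nonneg _) fun i _ => hb i
    calc |a i * ∏ i ∈ s, a i - b i * ∏ i ∈ s, b i|
        = |(a i - b i) * ∏ i ∈ s, b i + a i * (∏ i ∈ s, a i - ∏ i ∈ s, b i)| := by
          congr 1; ring
      _ ≤ |a i - b i| * |∏ i ∈ s, b i| + |a i| * |∏ i ∈ s, a i - ∏ i ∈ s, b i| := by
          rw [← abs_mul, ← abs_mul]; exact abs_add_le _ _
      _ ≤ |a i - b i| * 1 + 1 * |∏ i ∈ s, a i - ∏ i ∈ s, b i| := by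
          gcongr
          exact ha i
      _ ≤ _ := by linarith

variable {Ω : Type*} [MeasurableSpace Ω]

lemma integrable_exp_neg {μ : Measure Ω} [IsFiniteMeasure μ] {v : Ω → ℝ} (hv : Measurable v)
    (h0 : ∀ ω, 0 ≤ v ω) : Integrable (fun ω => Real.exp (-v ω)) μ :=
  Integrable.of_bound hv.neg.exp.aestronglyMeasurable 1 <| Eventually.of_forall fun ω => by
    simpa using h0 ω

/-- Both exponentials are within `C ^ 2` of their common linearization `1 - ∫ v`. -/
lemma abs_integral_exp_neg_sub_le {μ : Measure Ω} [IsProbabilityMeasure μ] {v : Ω → ℝ}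
    (hv : Measurable v) (h0 : ∀ ω, 0 ≤ v ω) {C : ℝ} (hC : ∀ ω, v ω ≤ C) :
    |∫ ω, Real.exp (-v ω) ∂μ - Real.exp (-∫ ω, v ω ∂μ)| ≤ 2 * C ^ 2 := by
  have hvi : Integrable v μ := Integrable.of_bound hv.aestronglyMeasurable C <|
    Eventually.of_forall fun ω => by simpa [abs_of_nonneg (h0 ω)] using hC ω
  have hexp := integrable_exp_neg (μ := μ) hv h0
  have hs0 : 0 ≤ ∫ ω, v ω ∂μ := integral_nonneg h0
  have hsC : ∫ ω, v ω ∂μ ≤ C := by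
    simpa using integral_mono hvi (integrable_const C) hC
  have h1 : |∫ ω, Real.exp (-v ω) ∂μ - (1 - ∫ ω, v ω ∂μ)| ≤ C ^ 2 := by
    have : ∫ ω, Real.exp (-v ω) ∂μ - (1 - ∫ ω, v ω ∂μ) =
        ∫ ω, (Real.exp (-v ω) - (1 - v ω)) ∂μ := by
      rw [integral_sub hexp (g := fun ω => 1 - v ω) ((integrable_const 1).sub hvi),
        integral_sub (integrable_const 1) hvi]
      simp
    rw [this]
    have hb := norm_integral_le_of_norm_le_const (μ := μ)
      (f := fun ω => Real.exp (-v ω) - (1 - v ω)) (C := C ^ 2) <|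
      Eventually.of_forall fun ω => (abs_exp_neg_sub_le (h0 ω)).trans
        (pow_le_pow_left₀ (h0 ω) (hC ω) 2)
    simpa using hb
  have h2 : |Real.exp (-∫ ω, v ω ∂μ) - (1 - ∫ ω, v ω ∂μ)| ≤ C ^ 2 :=
    (abs_exp_neg_sub_le hs0).trans (pow_le_pow_left₀ hs0 hsC 2)
  rw [abs_le] at *
  constructor <;> linarith [h1.1, h1.2, h2.1, h2.2]

/-- The product of the Laplace transforms of `n` independent bounded variables of common mean `s`,
at scale `1 / n`, tends to `exp (- s)`. -/
lemma tendsto_prod_integral_exp_neg {μ : ℕ → Measure Ω} [∀ i, IsProbabilityMeasure (μ i)]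
    {v : Ω → ℝ} (hv : Measurable v) (h0 : ∀ ω, 0 ≤ v ω) {C : ℝ} (hC : ∀ ω, v ω ≤ C) {s : ℝ}
    (hs : ∀ i, ∫ ω, v ω ∂(μ i) = s) :
    Tendsto (fun n : ℕ => ∏ i : Fin n, ∫ ω, Real.exp (-(v ω / n)) ∂(μ i)) atTop
      (𝓝 (Real.exp (-s))) := by
  have hs0 : 0 ≤ s := hs 0 ▸ integral_nonneg h0
  refine tendsto_iff_dist_tendsto_zero.2 ?_
  refine squeeze_zero' (Eventually.of_forall fun _ => dist_nonneg) ?_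
    (tendsto_const_div_atTop_nhds_zero_nat (2 * C ^ 2))
  filter_upwards [eventually_gt_atTop 0] with n hn
  have hn' : (0 : ℝ) < n := by exact_mod_cast hn
  have hprod : Real.exp (-s) = ∏ _i : Fin n, Real.exp (-(s / n)) := by
    rw [Finset.prod_const, Finset.card_univ, Fintype.card_fin, ← Real.exp_nat_mul]
    congr 1
    field_simp
  rw [Real.dist_eq, hprod]
  have hle (x : ℝ) (hx : 0 ≤ x) : |Real.exp (-x)| ≤ 1 := by
    simpa using hx
  -- There are `n` factors, each with error at most `2 (C / n)²`, for a total of `2 C² / n`.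
  refine (abs_prod_sub_prod_le _ (fun i => ?_) fun i => hle _ (by positivity)).trans ?_
  · have hb := norm_integral_le_of_norm_le_const (μ := μ i)
      (f := fun ω => Real.exp (-(v ω / n))) (C := 1) <|
      Eventually.of_forall fun ω => hle _ (div_nonneg (h0 ω) hn'.le)
    simpa using hb
  · have hterm (i : Fin n) : |∫ ω, Real.exp (-(v ω / n)) ∂(μ i) - Real.exp (-(s / n))| ≤
        2 * (C / n) ^ 2 := by
      have h := abs_integral_exp_neg_sub_le (μ := μ i) (hv.div_const (n : ℝ))
        (fun ω => div_nonneg (h0 ω) hn'.le) (C := C / n)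
        (fun ω => div_le_div_of_nonneg_right (hC ω) hn'.le)
      rwa [integral_div, hs] at h
    refine (Finset.sum_le_sum fun i _ => hterm i).trans (le_of_eq ?_)
    simp only [Finset.sum_const, Finset.card_univ, Fintype.card_fin, nsmul_eq_mul]
    field_simp

lemma integral_cexp_gaussianReal (t : ℝ) :
    ∫ x, Complex.exp ((x * t : ℝ) * Complex.I) ∂(gaussianReal 0 1) =
      (Real.exp (-(t ^ 2 / 2)) : ℝ) := by
  have h := charFun_gaussianReal (μ := 0) (v := 1) t
  rw [charFun_apply_real] at h
  convert h using 3
  · push_cast; ring_nf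
  · simp

lemma integral_cexp_pi_gaussianReal {ι : Type*} [Fintype ι] (w : ι → ℝ) :
    ∫ z, Complex.exp ((∑ j, z j * w j : ℝ) * Complex.I)
      ∂(Measure.pi fun _ : ι => gaussianReal 0 1) = (Real.exp (-((∑ j, w j ^ 2) / 2)) : ℝ) := by
  have (z : ι → ℝ) : Complex.exp ((∑ j, z j * w j : ℝ) * Complex.I) =
      ∏ j, Complex.exp ((z j * w j : ℝ) * Complex.I) := by
    rw [← Complex.exp_sum, Complex.ofReal_sum, Finset.sum_mul]
  simp only [this]
  rw [integral_fintype_prod_eq_prod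
    (f := fun j (x : ℝ) => Complex.exp ((x * w j : ℝ) * Complex.I))]
  simp only [integral_cexp_gaussianReal]
  rw [← Complex.ofReal_prod, ← Real.exp_sum, Finset.sum_div, Finset.sum_neg_distrib]

/-- For fixed `θ.1` the exponent is linear in independent standard normals, so these are integrated
first; what remains factors over `i`. For `n = 0` all sums and products are empty and the identity
still holds. -/
lemma integral_cexp_gaussian_mixture {n : ℕ} (μ : Fin n → Measure Ω)
    [∀ i, IsProbabilityMeasure (μ i)] {h : Ω → ℝ} (hh : Measurable h) (c : ℝ) :
    ∫ θ, Complex.exp ((1 / √(n : ℝ) * ∑ i, θ.2.1 i * h (θ.1 i) + c * θ.2.2 : ℝ) * Complex.I)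
      ∂((Measure.pi μ).prod
        ((Measure.pi fun _ : Fin n => gaussianReal 0 1).prod (gaussianReal 0 1))) =
      ((∏ i, ∫ ω, Real.exp (-(h ω ^ 2 / 2 / n)) ∂(μ i)) * Real.exp (-(c ^ 2 / 2)) : ℝ) := by
  have hmeas : Measurable fun θ : (Fin n → Ω) × (Fin n → ℝ) × ℝ =>
      1 / √(n : ℝ) * ∑ i, θ.2.1 i * h (θ.1 i) + c * θ.2.2 := by fun_prop
  rw [integral_prod _ (Integrable.of_bound (C := 1)
    (by fun_prop) (Eventually.of_forall fun θ => by rw [Complex.norm_exp_ofReal_mul_I]))]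
  have inner (u : Fin n → Ω) :
      ∫ y : (Fin n → ℝ) × ℝ, Complex.exp ((1 / √(n : ℝ) * ∑ i, y.1 i * h (u i) + c * y.2 : ℝ) *
        Complex.I) ∂((Measure.pi fun _ : Fin n => gaussianReal 0 1).prod (gaussianReal 0 1)) =
      (((∏ i, Real.exp (-(h (u i) ^ 2 / 2 / n))) * Real.exp (-(c ^ 2 / 2)) : ℝ) : ℂ) := by
    have split (y : (Fin n → ℝ) × ℝ) :
        Complex.exp ((1 / √(n : ℝ) * ∑ i, y.1 i * h (u i) + c * y.2 : ℝ) * Complex.I) =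
          Complex.exp ((∑ i, y.1 i * (h (u i) / √(n : ℝ)) : ℝ) * Complex.I) *
            Complex.exp ((y.2 * c : ℝ) * Complex.I) := by
      rw [← Complex.exp_add, ← add_mul, ← Complex.ofReal_add, Finset.mul_sum, mul_comm c]
      congr 4
      exact Finset.sum_congr rfl fun i _ => by ring
    simp only [split]
    rw [integral_prod_mul (fun z : Fin n → ℝ =>
        Complex.exp ((∑ i, z i * (h (u i) / √(n : ℝ)) : ℝ) * Complex.I))
      (fun b : ℝ => Complex.exp ((b * c : ℝ) * Complex.I)),
      integral_cexp_pi_gaussianReal, integral_cexp_gaussianReal, ← Complex.ofReal_mul,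
      ← Real.exp_sum, Finset.sum_div, Finset.sum_neg_distrib]
    congr 4
    refine Finset.sum_congr rfl fun i _ => ?_
    rw [div_pow, Real.sq_sqrt (Nat.cast_nonneg n)]
    ring
  simp only [inner]
  rw [integral_complex_ofReal, integral_mul_const, integral_fintype_prod_eq_prod
    (f := fun _ ω => Real.exp (-(h ω ^ 2 / 2 / n)))]

lemma integral_mul_self_gaussianReal : ∫ x : ℝ, x * x ∂(gaussianReal 0 1) = 1 := by
  have h := variance_id_gaussianReal (μ := 0) (v := 1)
  rw [variance_of_integral_eq_zero aemeasurable_id (by simp)] at h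
  simpa [pow_two] using h

section PiGaussian

variable {ι : Type*} [Fintype ι]

lemma integral_eval_pi_gaussianReal (i : ι) :
    ∫ z : ι → ℝ, z i ∂(Measure.pi fun _ => gaussianReal 0 1) = 0 := by
  rw [integral_comp_eval (μ := fun _ : ι => gaussianReal 0 1) (f := fun x : ℝ => x)
    aestronglyMeasurable_id]
  simp

lemma memLp_eval_pi_gaussianReal (i : ι) :
    MemLp (fun z : ι → ℝ => z i) 2 (Measure.pi fun _ => gaussianReal 0 1) :=
  (memLp_id_gaussianReal 2).comp_measurePreserving
    (measurePreserving_eval (fun _ : ι => gaussianReal 0 1) i)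

lemma integral_eval_mul_eval_pi_gaussianReal [DecidableEq ι] (i j : ι) :
    ∫ z : ι → ℝ, z i * z j ∂(Measure.pi fun _ => gaussianReal 0 1) = if i = j then 1 else 0 := by
  split_ifs with hij
  · subst hij
    rw [integral_comp_eval (μ := fun _ : ι => gaussianReal 0 1) (f := fun x : ℝ => x * x)
      (by fun_prop), integral_mul_self_gaussianReal]
  · have hind : IndepFun (fun z : ι → ℝ => z i) (fun z => z j)
        (Measure.pi fun _ => gaussianReal 0 1) :=
      (iIndepFun_pi (μ := fun _ : ι => gaussianReal 0 1) (X := fun _ => id)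
        fun _ => aemeasurable_id).indepFun hij
    rw [hind.integral_fun_mul_eq_mul_integral (memLp_eval_pi_gaussianReal i).aestronglyMeasurable
      (memLp_eval_pi_gaussianReal j).aestronglyMeasurable, integral_eval_pi_gaussianReal, zero_mul]

lemma integral_linear_pi_gaussianReal (w : ι → ℝ) :
    ∫ z : ι → ℝ, ∑ j, z j * w j ∂(Measure.pi fun _ => gaussianReal 0 1) = 0 := by
  rw [integral_finsetSum _ fun j _ =>
    ((memLp_eval_pi_gaussianReal j).integrable one_le_two).mul_const _]
  simp [integral_mul_const, integral_eval_pi_gaussianReal]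

lemma covariance_linear_pi_gaussianReal (w w' : ι → ℝ) :
    cov[fun z : ι → ℝ => ∑ j, z j * w j, fun z => ∑ j, z j * w' j;
      Measure.pi fun _ => gaussianReal 0 1] = ∑ j, w j * w' j := by
  classical
  have hL (w : ι → ℝ) (j : ι) : MemLp (fun z : ι → ℝ => z j * w j) 2
      (Measure.pi fun _ => gaussianReal 0 1) := (memLp_eval_pi_gaussianReal j).mul_const _
  rw [covariance_fun_sum_left (fun j => hL w j) (memLp_finsetSum _ fun j _ => hL w' j)]
  refine Finset.sum_congr rfl fun i _ => ?_
  rw [covariance_fun_sum_right (fun j => hL w' j) (hL w i)]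
  have hc (j : ι) : cov[fun z : ι → ℝ => z i * w i, fun z => z j * w' j;
      Measure.pi fun _ => gaussianReal 0 1] = if i = j then w i * w' j else 0 := by
    rw [covariance_mul_const_left, covariance_mul_const_right, covariance_eq_sub
      (memLp_eval_pi_gaussianReal i) (memLp_eval_pi_gaussianReal j),
      integral_eval_pi_gaussianReal, zero_mul, sub_zero]
    simp only [Pi.mul_apply, integral_eval_mul_eval_pi_gaussianReal]
    split_ifs <;> ring
  simp [hc]

end PiGaussian

/-- The independent centered weights make terms with different `i` uncorrelated, even with each
other's features, and decorrelate them from the bias. The `n` diagonal terms give `n * K`,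
normalized by `1 / n`; at `n = 0` the term `K` would be missing. -/
lemma covariance_gaussian_mixture {n : ℕ} (hn : 0 < n) (μ : Fin n → Measure Ω)
    [∀ i, IsProbabilityMeasure (μ i)] {h h' : Ω → ℝ} (hh : Measurable h) (hh' : Measurable h')
    {C C' : ℝ} (hC : ∀ ω, |h ω| ≤ C) (hC' : ∀ ω, |h' ω| ≤ C') {K : ℝ}
    (hK : ∀ i, ∫ ω, h ω * h' ω ∂(μ i) = K) (c : ℝ) :
    cov[fun θ : (Fin n → Ω) × (Fin n → ℝ) × ℝ =>
        1 / √(n : ℝ) * ∑ i, θ.2.1 i * h (θ.1 i) + c * θ.2.2,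
      fun θ => 1 / √(n : ℝ) * ∑ i, θ.2.1 i * h' (θ.1 i) + c * θ.2.2;
      (Measure.pi μ).prod
        ((Measure.pi fun _ : Fin n => gaussianReal 0 1).prod (gaussianReal 0 1))] =
      K + c ^ 2 := by
  set P := (Measure.pi μ).prod
        ((Measure.pi fun _ : Fin n => gaussianReal 0 1).prod (gaussianReal 0 1)) with hP
  -- Every moment below has this product form in unitaries, weights and bias.
  have hfac (f : (Fin n → Ω) → ℝ) (g : (Fin n → ℝ) → ℝ) (k : ℝ → ℝ) :
      ∫ θ, f θ.1 * (g θ.2.1 * k θ.2.2) ∂P = (∫ u, f u ∂(Measure.pi μ)) *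
        ((∫ z, g z ∂(Measure.pi fun _ : Fin n => gaussianReal 0 1)) *
          ∫ b, k b ∂(gaussianReal 0 1)) := by
    rw [hP, integral_prod_mul f (fun y : (Fin n → ℝ) × ℝ => g y.1 * k y.2), integral_prod_mul g k]
  have hW (i : Fin n) : MemLp (fun θ : (Fin n → Ω) × (Fin n → ℝ) × ℝ => θ.2.1 i) 2 P :=
    (memLp_eval_pi_gaussianReal i).comp_measurePreserving
      (measurePreserving_fst.comp measurePreserving_snd)
  have hb : MemLp (fun θ : (Fin n → Ω) × (Fin n → ℝ) × ℝ => θ.2.2) 2 P :=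
    (memLp_id_gaussianReal 2).comp_measurePreserving
      (measurePreserving_snd.comp measurePreserving_snd)
  have hY {g : Ω → ℝ} (hg : Measurable g) {D : ℝ} (hD : ∀ ω, |g ω| ≤ D) (i : Fin n) :
      MemLp (fun θ : (Fin n → Ω) × (Fin n → ℝ) × ℝ => θ.2.1 i * g (θ.1 i)) 2 P := by
    refine (hW i).of_le_mul (c := D) (by fun_prop) (Eventually.of_forall fun θ => ?_)
    rw [norm_mul, mul_comm]
    exact mul_le_mul_of_nonneg_right (hD _) (norm_nonneg _)
  have hYmean (g : Ω → ℝ) (i : Fin n) :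
      ∫ θ : (Fin n → Ω) × (Fin n → ℝ) × ℝ, θ.2.1 i * g (θ.1 i) ∂P = 0 := by
    have := hfac (fun u => g (u i)) (fun z => z i) (fun _ => 1)
    rw [integral_eval_pi_gaussianReal, zero_mul, mul_zero] at this
    rw [← this]
    exact integral_congr_ae (Eventually.of_forall fun θ => by simp [mul_comm])
  have hbmean : ∫ θ : (Fin n → Ω) × (Fin n → ℝ) × ℝ, θ.2.2 ∂P = 0 := by
    simpa using hfac (fun _ => 1) (fun _ => 1) (fun b => b)
  have hYY (i j : Fin n) :
      cov[fun θ : (Fin n → Ω) × (Fin n → ℝ) × ℝ => θ.2.1 i * h (θ.1 i),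
        fun θ => θ.2.1 j * h' (θ.1 j); P] = if i = j then K else 0 := by
    rw [covariance_eq_sub (hY hh hC i) (hY hh' hC' j), hYmean, zero_mul, sub_zero]
    have := hfac (fun u => h (u i) * h' (u j)) (fun z => z i * z j) (fun _ => 1)
    rw [integral_eval_mul_eval_pi_gaussianReal] at this
    rw [integral_congr_ae (g := fun θ => h (θ.1 i) * h' (θ.1 j) * (θ.2.1 i * θ.2.1 j * 1))
      (Eventually.of_forall fun θ => by simp only [Pi.mul_apply]; ring), this]
    split_ifs with hij
    · subst hij
      rw [integral_comp_eval (μ := μ) (f := fun ω : Ω => h ω * h' ω)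
        (hh.mul hh').aestronglyMeasurable, hK]
      simp
    · simp
  have hYb (g : Ω → ℝ) (hg : Measurable g) {D : ℝ} (hD : ∀ ω, |g ω| ≤ D) (i : Fin n) :
      cov[fun θ : (Fin n → Ω) × (Fin n → ℝ) × ℝ => θ.2.1 i * g (θ.1 i), fun θ => θ.2.2; P] = 0 := by
    rw [covariance_eq_sub (hY hg hD i) hb, hYmean, zero_mul, sub_zero]
    have := hfac (fun u => g (u i)) (fun z => z i) (fun b => b)
    rw [integral_eval_pi_gaussianReal, zero_mul, mul_zero] at this
    rw [← this]
    exact integral_congr_ae (Eventually.of_forall fun θ => by simp only [Pi.mul_apply]; ring)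
  have hbb : cov[fun θ : (Fin n → Ω) × (Fin n → ℝ) × ℝ => θ.2.2, fun θ => θ.2.2; P] = 1 := by
    rw [covariance_eq_sub hb hb, hbmean, zero_mul, sub_zero]
    simpa [integral_mul_self_gaussianReal] using hfac (fun _ => 1) (fun _ => 1) (fun b => b * b)
  have hS {g : Ω → ℝ} (hg : Measurable g) {D : ℝ} (hD : ∀ ω, |g ω| ≤ D) :
      MemLp (fun θ : (Fin n → Ω) × (Fin n → ℝ) × ℝ => ∑ i, θ.2.1 i * g (θ.1 i)) 2 P :=
    memLp_finsetSum _ fun i _ => hY hg hD i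
  have hSb {g : Ω → ℝ} (hg : Measurable g) {D : ℝ} (hD : ∀ ω, |g ω| ≤ D) :
      cov[fun θ : (Fin n → Ω) × (Fin n → ℝ) × ℝ => ∑ i, θ.2.1 i * g (θ.1 i), fun θ => θ.2.2; P] =
        0 := by
    rw [covariance_fun_sum_left (fun i => hY hg hD i) hb]
    simp [hYb g hg hD]
  have hSS : cov[fun θ : (Fin n → Ω) × (Fin n → ℝ) × ℝ => ∑ i, θ.2.1 i * h (θ.1 i),
      fun θ => ∑ i, θ.2.1 i * h' (θ.1 i); P] = n * K := by
    rw [covariance_fun_sum_left (fun i => hY hh hC i) (hS hh' hC')]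
    simp [covariance_fun_sum_right (fun j => hY hh' hC' j) (hY hh hC _), hYY]
  have hn' : (0 : ℝ) < n := by exact_mod_cast hn
  have hadd {F G F' G' : (Fin n → Ω) × (Fin n → ℝ) × ℝ → ℝ} (hF : MemLp F 2 P) (hG : MemLp G 2 P)
      (hF' : MemLp F' 2 P) (hG' : MemLp G' 2 P) :
      cov[fun θ => F θ + G θ, fun θ => F' θ + G' θ; P] =
        cov[F, F'; P] + cov[F, G'; P] + (cov[G, F'; P] + cov[G, G'; P]) := by
    change cov[F + G, F' + G'; P] = _
    rw [covariance_add_left hF hG (hF'.add hG'), covariance_add_right hF hF' hG',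
      covariance_add_right hG hF' hG']
  rw [hadd ((hS hh hC).const_mul _) (hb.const_mul c) ((hS hh' hC').const_mul _) (hb.const_mul c)]
  simp only [covariance_const_mul_left, covariance_const_mul_right, hSS, hSb hh hC, hbb,
    covariance_comm (fun θ : (Fin n → Ω) × (Fin n → ℝ) × ℝ => θ.2.2)
      (fun θ => ∑ i, θ.2.1 i * h' (θ.1 i)), hSb hh' hC']
  have hsq : 1 / √(n : ℝ) * (1 / √(n : ℝ)) = 1 / n := by
    rw [div_mul_div_comm, one_mul, Real.mul_self_sqrt hn'.le]
  rw [show 1 / √(n : ℝ) * (1 / √(n : ℝ) * (n * K)) = 1 / √(n : ℝ) * (1 / √(n : ℝ)) * (n * K) by ring,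
    hsq]
  field_simp
  ring

end Probability

/-! ### Convergence in distribution from characteristic functions. -/

lemma charFun_map_euclideanSpace {ι Ω : Type*} [Fintype ι] [MeasurableSpace Ω] (μ : Measure Ω)
    {Y : Ω → EuclideanSpace ℝ ι} (hY : Measurable Y) (t : EuclideanSpace ℝ ι) :
    charFun (μ.map Y) t = ∫ ω, Complex.exp ((∑ i, Y ω i * t i : ℝ) * Complex.I) ∂μ := by
  rw [charFun_apply, integral_map hY.aemeasurable (by fun_prop)]
  simp [PiLp.inner_apply, mul_comm]

/-- Cramér–Wold form of the Lévy convergence theorem for random vectors indexed by a finite type. -/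
lemma tendstoInDistribution_pi_of_tendsto_charFun {ι : Type*} [Fintype ι] {Ω : ℕ → Type*}
    {Ω' : Type*} [∀ n, MeasurableSpace (Ω n)] [MeasurableSpace Ω'] {X : (n : ℕ) → Ω n → ι → ℝ}
    {Z : Ω' → ι → ℝ} {μ : (n : ℕ) → Measure (Ω n)} [∀ n, IsProbabilityMeasure (μ n)]
    {μ' : Measure Ω'} [IsProbabilityMeasure μ'] (hX : ∀ n, Measurable (X n)) (hZ : Measurable Z)
    (h : ∀ t : ι → ℝ, Tendsto
      (fun n => ∫ ω, Complex.exp ((∑ i, X n ω i * t i : ℝ) * Complex.I) ∂(μ n)) atTop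
      (𝓝 (∫ ω, Complex.exp ((∑ i, Z ω i * t i : ℝ) * Complex.I) ∂μ'))) :
    TendstoInDistribution X atTop Z μ μ' := by
  have hX' (n) : Measurable fun ω => WithLp.toLp 2 (X n ω) :=
    (WithLp.measurable_toLp 2 _).comp (hX n)
  have hZ' : Measurable fun ω => WithLp.toLp 2 (Z ω) := (WithLp.measurable_toLp 2 _).comp hZ
  -- Characteristic functions need an inner product, so the vectors are moved to Euclidean space and
  -- brought back by continuous mapping.
  have key : TendstoInDistribution (E := EuclideanSpace ℝ ι) (fun n ω => WithLp.toLp 2 (X n ω))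
      atTop (fun ω => WithLp.toLp 2 (Z ω)) μ μ' := by
    refine ⟨fun n => (hX' n).aemeasurable, hZ'.aemeasurable, ?_⟩
    refine ProbabilityMeasure.tendsto_iff_tendsto_charFun.2 fun t => ?_
    have e1 := charFun_map_euclideanSpace μ' hZ' t
    have e2 (n) := charFun_map_euclideanSpace (μ n) (hX' n) t
    simp only [ProbabilityMeasure.coe_mk, e1, e2]
    exact h t
  exact key.continuous_comp (g := WithLp.ofLp) (PiLp.continuous_ofLp 2 _)

/-! ### An explicit model of the limiting Gaussian process. -/

section Limit

variable {X : Type*} {m nQ : ℕ}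

/-- The real and imaginary parts of the entries of the reduced density matrices of an input. -/
noncomputable def densityVector (Uenc : X → Matrix.unitaryGroup (Register m nQ) ℂ) (x : X)
    (j : (Fin nQ × Block m × Block m) × Bool) : ℝ :=
  if j.2 then (reducedDensity (Uenc x) j.1.1 j.1.2.1 j.1.2.2).re
  else (reducedDensity (Uenc x) j.1.1 j.1.2.1 j.1.2.2).im

/-- The kernel is a Gram kernel in a Euclidean space whose dimension does not depend on `X`. Hence
the limit process can be built on any `X` from finitely many normals, without an extension theorem.
-/
lemma sum_densityVector_mul (Uenc : X → Matrix.unitaryGroup (Register m nQ) ℂ) (x x' : X) :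
    ∑ j, densityVector Uenc x j * densityVector Uenc x' j = projectedQuantumKernel Uenc x x' := by
  rw [Fintype.sum_prod_type, Fintype.sum_prod_type, projectedQuantumKernel]
  refine Finset.sum_congr rfl fun k _ => ?_
  rw [Fintype.sum_prod_type, trace_mul_re_eq_sum (isHermitian_reducedDensity _ _)]
  simp [densityVector]

/-- A centered Gaussian process with covariance `κ` times the projected quantum kernel, realized on
finitely many independent standard normal variables. -/
noncomputable def limitProcess (Uenc : X → Matrix.unitaryGroup (Register m nQ) ℂ) (κ : ℝ)
    (z : (Fin nQ × Block m × Block m) × Bool → ℝ) (x : X) : ℝ :=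
  ∑ j, z j * (√κ * densityVector Uenc x j)

lemma measurable_limitProcess (Uenc : X → Matrix.unitaryGroup (Register m nQ) ℂ) (κ : ℝ) :
    Measurable (limitProcess Uenc κ) := by
  refine measurable_pi_iff.2 fun x => ?_
  unfold limitProcess
  fun_prop

/-- The law of the limiting Gaussian process. -/
noncomputable def limitLaw (Uenc : X → Matrix.unitaryGroup (Register m nQ) ℂ) (κ : ℝ) :
    ProbabilityMeasure (X → ℝ) :=
  ⟨(Measure.pi fun _ => gaussianReal 0 1).map (limitProcess Uenc κ),
    Measure.isProbabilityMeasure_map (measurable_limitProcess Uenc κ).aemeasurable⟩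

lemma sum_scaled_densityVector_mul (Uenc : X → Matrix.unitaryGroup (Register m nQ) ℂ) {κ : ℝ}
    (hκ : 0 ≤ κ) (x x' : X) :
    ∑ j, (√κ * densityVector Uenc x j) * (√κ * densityVector Uenc x' j) =
      κ * projectedQuantumKernel Uenc x x' := by
  rw [← sum_densityVector_mul, Finset.mul_sum]
  refine Finset.sum_congr rfl fun j _ => ?_
  rw [mul_mul_mul_comm, Real.mul_self_sqrt hκ]

lemma integral_limitLaw (Uenc : X → Matrix.unitaryGroup (Register m nQ) ℂ) (κ : ℝ) (x : X) :
    ∫ g, g x ∂(limitLaw Uenc κ : Measure (X → ℝ)) = 0 := by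
  rw [limitLaw, ProbabilityMeasure.coe_mk, integral_map
    (measurable_limitProcess Uenc κ).aemeasurable (measurable_pi_apply x).aestronglyMeasurable]
  exact integral_linear_pi_gaussianReal _

lemma covariance_limitLaw (Uenc : X → Matrix.unitaryGroup (Register m nQ) ℂ) {κ : ℝ}
    (hκ : 0 ≤ κ) (x x' : X) :
    cov[fun g => g x, fun g => g x'; (limitLaw Uenc κ : Measure (X → ℝ))] =
      κ * projectedQuantumKernel Uenc x x' := by
  rw [limitLaw, ProbabilityMeasure.coe_mk, covariance_map
    (measurable_pi_apply x).aestronglyMeasurable (measurable_pi_apply x').aestronglyMeasurable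
    (measurable_limitProcess Uenc κ).aemeasurable, ← sum_scaled_densityVector_mul Uenc hκ]
  exact covariance_linear_pi_gaussianReal _ _

lemma isGaussianProcess_limitLaw (Uenc : X → Matrix.unitaryGroup (Register m nQ) ℂ) (κ : ℝ) :
    IsGaussianProcess (fun (x : X) (g : X → ℝ) => g x) (limitLaw Uenc κ : Measure (X → ℝ)) := by
  refine ⟨fun I => ⟨?_⟩⟩
  -- Each finite-dimensional marginal is a linear image of a standard Gaussian vector.
  let L : ((Fin nQ × Block m × Block m) × Bool → ℝ) →ₗ[ℝ] (I → ℝ) :=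
    { toFun := fun z x => limitProcess Uenc κ z x
      map_add' := fun z z' => by
        funext x
        simp [limitProcess, add_mul, Finset.sum_add_distrib]
      map_smul' := fun r z => by
        funext x
        simp [limitProcess, mul_assoc, Finset.mul_sum] }
  have hid : HasGaussianLaw (fun z : (Fin nQ × Block m × Block m) × Bool → ℝ => z)
      (Measure.pi fun _ => gaussianReal 0 1) :=
    iIndepFun.hasGaussianLaw (X := fun j (z : (Fin nQ × Block m × Block m) × Bool → ℝ) => z j)
      (fun j => ⟨by rw [(measurePreserving_eval _ j).map_eq]; infer_instance⟩)
      (iIndepFun_pi (X := fun _ => id) fun _ => aemeasurable_id)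
  rw [limitLaw, ProbabilityMeasure.coe_mk, Measure.map_map (by fun_prop)
    (measurable_limitProcess Uenc κ)]
  exact (hid.map_fun L.toContinuousLinearMap).isGaussian_map

lemma integral_cexp_limitLaw (Uenc : X → Matrix.unitaryGroup (Register m nQ) ℂ) {κ : ℝ}
    (hκ : 0 ≤ κ) (I : Finset X) (t : I → ℝ) :
    ∫ g, Complex.exp ((∑ x : I, g x * t x : ℝ) * Complex.I) ∂(limitLaw Uenc κ : Measure (X → ℝ)) =
      (Real.exp (-((∑ x : I, ∑ x' : I, t x * t x' * (κ * projectedQuantumKernel Uenc x x')) / 2)) :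
        ℝ) := by
  rw [limitLaw, ProbabilityMeasure.coe_mk, integral_map
    (measurable_limitProcess Uenc κ).aemeasurable
    (Measurable.aestronglyMeasurable (by fun_prop))]
  have h1 (z : (Fin nQ × Block m × Block m) × Bool → ℝ) :
      ∑ x : I, limitProcess Uenc κ z x * t x =
        ∑ j, z j * ∑ x : I, t x * (√κ * densityVector Uenc x j) := by
    simp only [limitProcess, Finset.sum_mul, Finset.mul_sum]
    rw [Finset.sum_comm]
    exact Finset.sum_congr rfl fun j _ => Finset.sum_congr rfl fun x _ => by ring
  simp only [h1]
  rw [integral_cexp_pi_gaussianReal]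
  congr 4
  simp only [← sum_scaled_densityVector_mul Uenc hκ, Finset.mul_sum, pow_two, Finset.sum_mul]
  rw [Finset.sum_comm]
  refine Finset.sum_congr rfl fun x _ => ?_
  rw [Finset.sum_comm]
  refine Finset.sum_congr rfl fun x' _ => Finset.sum_congr rfl fun j _ => ?_
  ring

end Limit

/-! ### Convergence of the network, uniqueness of the limit, and covariances. -/

section Network

variable {X : Type*} {m nQ : ℕ}

lemma measurable_output (Uenc : X → Matrix.unitaryGroup (Register m nQ) ℂ)
    (𝒪 : Matrix (Block m) (Block m) ℂ) (ξ : ℝ) (n : ℕ) (x : X) :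
    Measurable fun θ => output Uenc 𝒪 ξ n θ x := by
  have h := measurable_quantumFeature 𝒪 (Uenc x)
  unfold output
  fun_prop

/-- A linear combination of outputs is again such a network with the single feature `h` and bias
scale `ξ * τ`, so the scalar mixture computation applies with `v = h² / 2`. -/
lemma tendsto_integral_cexp_output (hm : 1 ≤ m) (Uenc : X → Matrix.unitaryGroup (Register m nQ) ℂ)
    {𝒪 : Matrix (Block m) (Block m) ℂ} (h𝒪 : 𝒪.IsHermitian) (htr : 𝒪.trace = 0)
    {ν : ℕ → Fin nQ → ProbabilityMeasure (Matrix.unitaryGroup (Block m) ℂ)}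
    (hν : ∀ i k, IsUnitaryTwoDesign (ν i k)) (ξ : ℝ) (I : Finset X) (t : I → ℝ) :
    Tendsto (fun n => ∫ θ, Complex.exp ((∑ x : I, output Uenc 𝒪 ξ n θ x * t x : ℝ) * Complex.I)
        ∂(initLaw ν n)) atTop
      (𝓝 (Real.exp (-((∑ x : I, ∑ x' : I, t x * t x' *
        (featureKernel Uenc 𝒪 x x' + ξ ^ 2)) / 2)) : ℝ)) := by
  set h : (Fin nQ → Matrix.unitaryGroup (Block m) ℂ) → ℝ :=
    fun U => ∑ x : I, t x * quantumFeature 𝒪 (Uenc x) U with hh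
  have hmeas : Measurable h :=
    Finset.measurable_sum _ fun x _ => (measurable_quantumFeature 𝒪 _).const_mul _
  choose C hC using fun x => exists_bound_quantumFeature 𝒪 (Uenc x)
  have hbound (U) : |h U| ≤ ∑ x : I, |t x| * C x :=
    (Finset.abs_sum_le_sum_abs _ _).trans <| Finset.sum_le_sum fun x _ => by
      rw [abs_mul]; exact mul_le_mul_of_nonneg_left (hC x U) (abs_nonneg _)
  set s := ∑ x : I, ∑ x' : I, t x * t x' * featureKernel Uenc 𝒪 x x' with hs
  have hint (i : ℕ) : ∫ U, h U ^ 2 / 2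
      ∂(Measure.pi fun k => (ν i k : Measure (Matrix.unitaryGroup (Block m) ℂ))) = s / 2 := by
    set P := Measure.pi fun k => (ν i k : Measure (Matrix.unitaryGroup (Block m) ℂ))
    have hI (x x' : I) : Integrable (fun U => t x * t x' * (quantumFeature 𝒪 (Uenc x) U *
        quantumFeature 𝒪 (Uenc x') U)) P := by
      refine (Integrable.of_bound ((measurable_quantumFeature 𝒪 _).mul
        (measurable_quantumFeature 𝒪 _)).aestronglyMeasurable (C x * C x') ?_).const_mul _
      refine Eventually.of_forall fun U => ?_
      rw [Pi.mul_apply, Real.norm_eq_abs, abs_mul]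
      exact mul_le_mul (hC _ U) (hC _ U) (abs_nonneg _) ((abs_nonneg _).trans (hC _ U))
    have e (U) : h U ^ 2 = ∑ x : I, ∑ x' : I, t x * t x' * (quantumFeature 𝒪 (Uenc x) U *
        quantumFeature 𝒪 (Uenc x') U) := by
      simp only [hh, pow_two, Finset.sum_mul_sum]
      exact Finset.sum_congr rfl fun x _ => Finset.sum_congr rfl fun x' _ => by ring
    rw [integral_div]
    simp only [e]
    rw [integral_finsetSum _ fun x _ => integrable_finsetSum _ fun x' _ => hI x x']
    congr 1
    refine Finset.sum_congr rfl fun x _ => ?_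
    rw [integral_finsetSum _ fun x' _ => hI x x']
    refine Finset.sum_congr rfl fun x' _ => ?_
    rw [integral_const_mul, integral_quantumFeature_mul hm Uenc h𝒪 htr (hν i)]
  set τ := ∑ x : I, t x
  have hchar (n : ℕ) : ∫ θ, Complex.exp ((∑ x : I, output Uenc 𝒪 ξ n θ x * t x : ℝ) * Complex.I)
        ∂(initLaw ν n) = ((∏ i : Fin n, ∫ U, Real.exp (-(h U ^ 2 / 2 / n))
          ∂(Measure.pi fun k => (ν i k : Measure (Matrix.unitaryGroup (Block m) ℂ)))) *
          Real.exp (-((ξ * τ) ^ 2 / 2)) : ℝ) := by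
    rw [← integral_cexp_gaussian_mixture _ hmeas]
    refine integral_congr_ae (Eventually.of_forall fun θ => ?_)
    have : ∑ x : I, output Uenc 𝒪 ξ n θ x * t x =
        1 / √(n : ℝ) * ∑ i, θ.2.1 i * h (θ.1 i) + ξ * τ * θ.2.2 := by
      simp only [output, hh, τ, add_mul, Finset.sum_add_distrib, Finset.mul_sum, Finset.sum_mul]
      congr 1
      · rw [Finset.sum_comm]
        exact Finset.sum_congr rfl fun i _ => Finset.sum_congr rfl fun x _ => by ring
      · exact Finset.sum_congr rfl fun x _ => by ring
    simp only [this]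
  simp only [hchar]
  refine (Complex.continuous_ofReal.tendsto _).comp ?_
  have hlim := (tendsto_prod_integral_exp_neg
    (μ := fun i => Measure.pi fun k => (ν i k : Measure (Matrix.unitaryGroup (Block m) ℂ)))
    (v := fun U => h U ^ 2 / 2) (by fun_prop) (fun U => by positivity)
    (C := (∑ x : I, |t x| * C x) ^ 2 / 2)
    (fun U => by
      have := sq_le_sq' (abs_le.1 (hbound U)).1 (abs_le.1 (hbound U)).2
      linarith) hint).mul_const (Real.exp (-((ξ * τ) ^ 2 / 2)))
  convert hlim using 2
  rw [← Real.exp_add]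
  congr 1
  have hτ : ∑ x : I, ∑ x' : I, t x * t x' * ξ ^ 2 = (ξ * τ) ^ 2 := by
    have : τ * τ = ∑ x : I, ∑ x' : I, t x * t x' := Finset.sum_mul_sum _ _ _ _
    simp only [← Finset.sum_mul]
    rw [← this]
    ring
  simp only [mul_add, Finset.sum_add_distrib, hτ, ← hs]
  ring

lemma isInfiniteWidthLimit_limitLaw (hm : 1 ≤ m) (Uenc : X → Matrix.unitaryGroup (Register m nQ) ℂ)
    {𝒪 : Matrix (Block m) (Block m) ℂ} (h𝒪 : 𝒪.IsHermitian) (htr : 𝒪.trace = 0)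
    {ν : ℕ → Fin nQ → ProbabilityMeasure (Matrix.unitaryGroup (Block m) ℂ)}
    (hν : ∀ i k, IsUnitaryTwoDesign (ν i k)) {ξ κ : ℝ} (hκ : 0 ≤ κ)
    (hker : ∀ x x', featureKernel Uenc 𝒪 x x' + ξ ^ 2 = κ * projectedQuantumKernel Uenc x x') :
    IsInfiniteWidthLimit Uenc 𝒪 ν ξ (limitLaw Uenc κ) := by
  intro I
  refine tendstoInDistribution_pi_of_tendsto_charFun
    (fun n => measurable_pi_iff.2 fun x => measurable_output Uenc 𝒪 ξ n x) (by fun_prop)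
    fun t => ?_
  rw [integral_cexp_limitLaw Uenc hκ]
  simpa only [hker] using tendsto_integral_cexp_output hm Uenc h𝒪 htr hν ξ I t

/-- Limits in distribution are unique on each finite set of inputs, and the finite-dimensional
marginals determine a finite measure on the product space. -/
lemma IsInfiniteWidthLimit.unique {Uenc : X → Matrix.unitaryGroup (Register m nQ) ℂ}
    {𝒪 : Matrix (Block m) (Block m) ℂ}
    {ν : ℕ → Fin nQ → ProbabilityMeasure (Matrix.unitaryGroup (Block m) ℂ)} {ξ : ℝ}
    {G G' : ProbabilityMeasure (X → ℝ)} (hG : IsInfiniteWidthLimit Uenc 𝒪 ν ξ G)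
    (hG' : IsInfiniteWidthLimit Uenc 𝒪 ν ξ G') : G = G' := by
  have h (I : Finset X) : (G : Measure (X → ℝ)).map I.restrict = (G' : Measure (X → ℝ)).map
      I.restrict := tendstoInDistribution_unique _ (hG I) (hG' I)
  have hfin (I : Finset X) : IsFiniteMeasure ((G' : Measure (X → ℝ)).map I.restrict) :=
    inferInstance
  exact Subtype.ext (IsProjectiveLimit.unique h fun I => rfl)

lemma covariance_output (hm : 1 ≤ m) (Uenc : X → Matrix.unitaryGroup (Register m nQ) ℂ)
    {𝒪 : Matrix (Block m) (Block m) ℂ} (h𝒪 : 𝒪.IsHermitian) (htr : 𝒪.trace = 0)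
    {ν : ℕ → Fin nQ → ProbabilityMeasure (Matrix.unitaryGroup (Block m) ℂ)}
    (hν : ∀ i k, IsUnitaryTwoDesign (ν i k)) (ξ : ℝ) {n : ℕ} (hn : 0 < n) (x x' : X) :
    cov[fun θ => output Uenc 𝒪 ξ n θ x, fun θ => output Uenc 𝒪 ξ n θ x'; initLaw ν n] =
      featureKernel Uenc 𝒪 x x' + ξ ^ 2 := by
  obtain ⟨C, hC⟩ := exists_bound_quantumFeature 𝒪 (Uenc x)
  obtain ⟨C', hC'⟩ := exists_bound_quantumFeature 𝒪 (Uenc x')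
  exact covariance_gaussian_mixture hn
    (fun i : Fin n => Measure.pi fun k => (ν i k : Measure (Matrix.unitaryGroup (Block m) ℂ)))
    (measurable_quantumFeature 𝒪 _) (measurable_quantumFeature 𝒪 _) hC hC'
    (fun i => integral_quantumFeature_mul hm Uenc h𝒪 htr (hν i) x x') ξ

end Network

end QCNN

theorem mainTheorem5 {X : Type*} {m nQ : ℕ} (hm : 1 ≤ m)
    (Uenc : X → Matrix.unitaryGroup (Register m nQ) ℂ)
    (𝒪 : Matrix (Block m) (Block m) ℂ) (h𝒪 : 𝒪.IsHermitian) (htr : 𝒪.trace = 0)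
    (ν : ℕ → Fin nQ → ProbabilityMeasure (Matrix.unitaryGroup (Block m) ℂ))
    (hν : ∀ i k, IsUnitaryTwoDesign (ν i k))
    (ξ : ℝ) (hξ : ξ = √((nQ : ℝ) * (𝒪 ^ 2).trace.re / (((2 : ℝ) ^ (2 * m) - 1) * 2 ^ m))) :
    (∃ G : ProbabilityMeasure (X → ℝ), IsInfiniteWidthLimit Uenc 𝒪 ν ξ G) ∧
    (∀ G : ProbabilityMeasure (X → ℝ), IsInfiniteWidthLimit Uenc 𝒪 ν ξ G →
      IsGaussianProcess (fun (x : X) (g : X → ℝ) => g x) (G : Measure (X → ℝ)) ∧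
      (∀ x, ∫ g, g x ∂(G : Measure (X → ℝ)) = 0) ∧
      ∀ x x', cov[fun g => g x, fun g => g x'; (G : Measure (X → ℝ))] =
        (𝒪 ^ 2).trace.re / ((2 : ℝ) ^ (2 * m) - 1) * projectedQuantumKernel Uenc x x') ∧
    ∀ x x', Tendsto
      (fun n₀ : ℕ => cov[fun θ => output Uenc 𝒪 ξ n₀ θ x, fun θ => output Uenc 𝒪 ξ n₀ θ x';
        initLaw ν n₀]) atTop
      (𝓝 ((𝒪 ^ 2).trace.re / ((2 : ℝ) ^ (2 * m) - 1) * projectedQuantumKernel Uenc x x')) := by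
  have htr2 : 0 ≤ (𝒪 ^ 2).trace.re := by
    rw [pow_two, trace_mul_re_eq_sum h𝒪]
    exact Finset.sum_nonneg fun a _ => Finset.sum_nonneg fun b _ =>
      add_nonneg (mul_self_nonneg _) (mul_self_nonneg _)
  have hden : 0 < (2 : ℝ) ^ (2 * m) - 1 :=
    sub_pos.2 (one_lt_pow₀ one_lt_two (by omega))
  have hκ : 0 ≤ (𝒪 ^ 2).trace.re / ((2 : ℝ) ^ (2 * m) - 1) := div_nonneg htr2 hden.le
  -- The choice of `ξ` enters here: `ξ ^ 2` is the constant subtracted in `featureKernel`.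
  have hker (x x' : X) : featureKernel Uenc 𝒪 x x' + ξ ^ 2 =
      (𝒪 ^ 2).trace.re / ((2 : ℝ) ^ (2 * m) - 1) * projectedQuantumKernel Uenc x x' := by
    rw [hξ, Real.sq_sqrt (by positivity), featureKernel]
    have := hden.ne'
    field_simp
    ring
  have hlim := isInfiniteWidthLimit_limitLaw hm Uenc h𝒪 htr hν hκ hker
  refine ⟨⟨_, hlim⟩, fun G hG => ?_, fun x x' => ?_⟩
  · rw [hG.unique hlim]
    exact ⟨isGaussianProcess_limitLaw Uenc _, integral_limitLaw Uenc _,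
      covariance_limitLaw Uenc hκ⟩
  -- The covariance already equals its limit at every positive width.
  · refine tendsto_const_nhds.congr' ?_
    filter_upwards [eventually_gt_atTop 0] with n hn
    rw [covariance_output hm Uenc h𝒪 htr hν ξ hn, hker]
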